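/- \textbf{Setting.} Let $P=(S,\mathcal A,\delta,r,\mathcal Z,\mathcal O,\lambda)$ be a finite POMDP ($\delta(\cdot\mid s,a)$ is the law of the next state, $r(s,a)$ the reward, $\mathcal O(\cdot\mid s)$ the law of the observation emitted in $s$, $\lambda$ the initial belief, $\mathcal A\neq\emptyset$). A history is a sequence $h=a_1o_1\cdots a_io_i$ of actions and observations that has positive probability under some choice of actions; $|h|=i$; $b_h$ is the Bayesian belief after $h$ (so $b_\epsilon=\lambda$), and $p(h,hao)=\sum_{s,s'}b_h(s)\,\delta(s'\mid s,a)\,\mathcal O(o\mid s')$. Rewards are observable: for every history $h$ and action $a$, $r(s,a)$ has the same value $\mathrm{rew}(h,a)$ for all $s$ with $b_h(s)>0$. Fix a discount factor $0<\gamma<1$, a horizon $N\in\mathbb N$, a threshold $\tau\in\mathbb R$, a risk bound $\alpha$ and an exploration constant $K>0$. The $n$-step payoff of a play $s_0a_1s_1a_2\cdots$ is $\mathsf{Disc}_{\gamma,n}=\sum_{i=0}^{n-1}\gamma^i r(s_i,a_{i+1})$. A policy $\sigma$ maps histories to distributions on actions; $\mathbb P^\sigma_b$ is the law of the play under $\sigma$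 from belief $b$. \textbf{Algorithm RAMCP.} It keeps a current root history $h_{\mathrm{root}}$ (initially $\epsilon$), a number of remaining steps $n$ (initially $N$), a threshold $\mathit{thr}$ (initially $\tau$), a risk bound $\mathit{rbound}$ (initially $\alpha$), two trees of histories $\mathcal T_{\mathrm{srch}},\mathcal T_{\mathrm{exp}}$ rooted in $h_{\mathrm{root}}$ (initially only the root), for nodes $h$ the attributes $h.N,\ h.N_a,\ h.V_a$ (initially $0$) and the risk bounds $h.U_a$ and $h.U$ (equal to $1$ as long as they have not been assigned). While $n>0$ it performs one decision step, consisting of: (a) \emph{Search.} Until $\mathit{timeout}$ calls of Simulate have been made: sample $s\sim b_{h_{\mathrm{root}}}$ and call Simulate$(s,h_{\mathrm{root}},n,0)$. Simulate$(s,h,d,\mathit{pay})$: if $d=0$, call UpdateTrees$(h)$ if $\mathit{pay}\ge\mathit{thr}$, and return $0$. Otherwise, if $h\notin\mathcal T_{\mathrm{srch}}$, add $h$ to $\mathcal T_{\mathrm{srch}}$ and return Rollout$(s,h,d,\mathit{pay})$. Otherwise choose $a$ maximizing $h.V_a+K\sqrt{\log(h.N)/h.N_a}$ (which is $+\infty$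 if $h.N_a=0$; ties are broken by an arbitrary, possibly randomized, rule), sample $s'\sim\delta(\cdot\mid s,a)$ and $o\sim\mathcal O(\cdot\mid s')$, set $R=r(s,a)+\gamma\cdot{}$Simulate$(s',hao,d-1,\mathit{pay}+\gamma^{n-d}r(s,a))$, increase $h.N$ and $h.N_a$ by $1$, replace $h.V_a$ by $h.V_a+(R-h.V_a)/h.N_a$, and return $R$. Rollout$(s,h,d,\mathit{pay})$ does the same for $d=0$; for $d>0$ it chooses $a$ uniformly at random, samples $s',o$ as above and returns $r(s,a)+\gamma\cdot{}$Rollout$(s',hao,d-1,\mathit{pay}+\gamma^{n-d}r(s,a))$. UpdateTrees$(h)$: add $h$ and all its prefixes extending $h_{\mathrm{root}}$ to $\mathcal T_{\mathrm{exp}}$, and set $h.U\leftarrow0$, $R\leftarrow 0$; then for $g=\hat g a o$ running from $h$ up to the child of $h_{\mathrm{root}}$, set $\hat g.U_{a'}\leftarrow1-\sum_{o'}p(\hat g,\hat ga'o')(1-\hat ga'o'.U)$ for every action $a'$ and $\hat g.U\leftarrow\min_{a'}\hat g.U_{a'}$; moreover, if $g\notin\mathcal T_{\mathrm{srch}}$,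 add $g$ to $\mathcal T_{\mathrm{srch}}$ and set $g.N\leftarrow1$, $g.N_a\leftarrow1$, $R\leftarrow R+\mathrm{rew}(\hat g,a)$, $g.V_a\leftarrow R$. (b) \emph{Action selection and play.} An action $a$ together with a vector $d^a\in\mathbb R^{\mathcal Z}$ is chosen by a (possibly randomized) rule from the current memory contents; the rule may be arbitrary, in particular it may solve the constrained MDP determined by the explicit tree. Then $a$ is played in $P$, an observation $o$ and a reward $R$ are received, and one sets $\mathit{thr}\leftarrow(\mathit{thr}-R)/\gamma$, $\mathit{rbound}\leftarrow d^a(o)$, $h_{\mathrm{root}}\leftarrow h_{\mathrm{root}}ao$, cuts both trees down to the subtree of the new root (the new root alone if it was not a node), and sets $n\leftarrow n-1$. \textbf{Lemma.} \begin{enumerate} \item At any point of any execution (that is, initially and after every call of Simulate and every played action, for arbitrary timeouts) there is a policy $\sigma$ with $$\mathbb P^{\sigma}_{b_{h_{\mathrm{root}}}}\bigl(\mathsf{Disc}_{\gamma,N-|h_{\mathrm{root}}|}<\mathit{thr}\bigr)\le h_{\mathrm{root}}.U .$$ \item As $\mathit{timeout}\to\infty$, the probability that $$h_{\mathrm{root}}.U=\inf_{\sigma}\mathbb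 P^{\sigma}_{b_{h_{\mathrm{root}}}}\bigl(\mathsf{Disc}_{\gamma,N-|h_{\mathrm{root}}|}<\mathit{thr}\bigr)$$ holds at some point of the search phase before $\mathit{timeout}$ expires converges to $1$. This holds both for a search started (or continued) from any fixed memory contents with $n>0$ that can occur in an execution, and, for each $k<N$, for the search phase of decision step $k$ (numbered from $0$) of a whole execution in which every search phase has the same $\mathit{timeout}$. \end{enumerate} -/

import Mathlib

open Filter Topology

noncomputable section

/-- A finite POMDP: transition function, reward function, observation function, initial belief.
(`S`, `A`, `Z` are assumed finite wherever this is used.) -/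
structure POMDP (S A Z : Type*) where
  trans : S → A → PMF S
  reward : S → A → ℝ
  obs : S → PMF Z
  init : PMF S

/-- Sequences of (action, observation) pairs, **latest pair first**: `h a o` is `(a, o) :: h`, and
`g` is a prefix of `h` in the usual order iff `g <:+ h`. -/
abbrev Hist (A Z : Type*) := List (A × Z)

/-- A (randomized, history-dependent) policy. -/
abbrev Policy (A Z : Type*) := Hist A Z → PMF A

/-- The memory of the algorithm. `root` is the common root of both trees; histories are counted
from the very beginning of the execution, so that all nodes of the trees extend `root`.
The attributes are total functions; a node that was never touched has the default values
(`cnt = cntA = 0`, `val = 0`, `U = 1`). -/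
structure Memory (A Z : Type*) where
  /-- the current root of the two trees -/
  root : Hist A Z
  /-- number of remaining decision steps -/
  n : ℕ
  /-- current payoff threshold -/
  thr : ℝ
  /-- current risk bound -/
  rbound : ℝ
  /-- nodes of the search tree -/
  srch : Set (Hist A Z)
  /-- nodes of the explicit tree -/
  exp : Set (Hist A Z)
  /-- `h.N` -/
  cnt : Hist A Z → ℕ
  /-- `h.N_a` -/
  cntA : Hist A Z → A → ℕ
  /-- `h.V_a` -/
  val : Hist A Z → A → ℝ
  /-- `h.U` -/
  U : Hist A Z → ℝ
  /-- `h.U_a` -/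
  Ua : Hist A Z → A → ℝ

namespace POMDP

variable {S A Z : Type*} [Fintype S] [Fintype A] [Fintype Z] [Nonempty A]

/-! ### Beliefs, histories, rewards -/

/-- Joint law of the next state and the observation when `a` is played from belief `b`. -/
def joint (P : POMDP S A Z) (b : PMF S) (a : A) : PMF (S × Z) :=
  b.bind fun s => (P.trans s a).bind fun s' => (P.obs s').map fun o => (s', o)

open Classical in
/-- Bayesian update of the belief `b` after playing `a` and observing `o`
(`b` itself if this observation has probability zero). -/
def updateBelief (P : POMDP S A Z) (b : PMF S) (a : A) (o : Z) : PMF S :=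
  if h : ∃ x ∈ {x : S × Z | x.2 = o}, x ∈ (P.joint b a).support then
    ((P.joint b a).filter {x | x.2 = o} h).map Prod.fst
  else b

/-- The belief `b_h`. -/
def belief (P : POMDP S A Z) : Hist A Z → PMF S
  | [] => P.init
  | (a, o) :: h => P.updateBelief (P.belief h) a o

/-- The probability `p(h, hao)` of observing `o` when `a` is played after history `h`. -/
def obsProb (P : POMDP S A Z) (h : Hist A Z) (a : A) (o : Z) : ℝ :=
  ∑ s, ∑ s', (P.belief h s).toReal * (P.trans s a s').toReal * (P.obs s' o).toReal

/-- The sequences that really are histories, i.e. correspond to some path of the POMDP. -/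
def IsHistory (P : POMDP S A Z) : Hist A Z → Prop
  | [] => True
  | (a, o) :: h => P.IsHistory h ∧ 0 < P.obsProb h a o

/-- Rewards are observable: the reward of an action is determined by the history. -/
def ObservableRewards (P : POMDP S A Z) : Prop :=
  ∀ h, P.IsHistory h → ∀ s ∈ (P.belief h).support, ∀ s' ∈ (P.belief h).support, ∀ a,
    P.reward s a = P.reward s' a

/-- `rew(h, a)`: the reward `r(s, a)` of any state `s` with `b_h(s) > 0`. -/
def rew (P : POMDP S A Z) (h : Hist A Z) (a : A) : ℝ :=
  P.reward (P.belief h).support_nonempty.some a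

/-! ### Payoff and risk -/

/-- The law of the first `n` steps `s₀ a₁ s₁ a₂ …` (as the list of the pairs `(sᵢ, aᵢ₊₁)`, `i < n`)
of a play from state `s` under the policy `σ`, when the history so far is `h`. -/
def playLaw (P : POMDP S A Z) (σ : Policy A Z) : ℕ → Hist A Z → S → PMF (List (S × A))
  | 0, _, _ => PMF.pure []
  | n + 1, h, s =>
      (σ h).bind fun a => (P.trans s a).bind fun s' => (P.obs s').bind fun o =>
        (P.playLaw σ n ((a, o) :: h) s').map fun w => (s, a) :: w

/-- Discounted payoff `∑ᵢ γ ^ i * r(sᵢ, aᵢ₊₁)` of a finite list of steps. -/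
def disc (P : POMDP S A Z) (γ : ℝ) : List (S × A) → ℝ
  | [] => 0
  | (s, a) :: w => P.reward s a + γ * P.disc γ w

/-- The probability that the `n`-step discounted payoff is `< thr` when the policy `σ` is followed
from belief `b`. -/
def risk (P : POMDP S A Z) (γ : ℝ) (σ : Policy A Z) (b : PMF S) (n : ℕ) (thr : ℝ) : ℝ :=
  ((b.bind fun s => P.playLaw σ n [] s).toOuterMeasure {w | P.disc γ w < thr}).toReal

/-- The minimal achievable risk `inf_σ`. -/
def minRisk (P : POMDP S A Z) (γ : ℝ) (b : PMF S) (n : ℕ) (thr : ℝ) : ℝ :=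
  ⨅ σ : Policy A Z, P.risk γ σ b n thr

/-! ### The procedure `UpdateTrees` -/

open Classical in
/-- The `repeat` loop of `UpdateTrees`: walk from the node `g` up to the root, update the risk
bounds of the parent, and add `g` to the search tree if it is missing there. -/
def backup (P : POMDP S A Z) : Hist A Z → ℝ → Memory A Z → Memory A Z
  | [], _, m => m
  | (a, o) :: g', R, m =>
      if (a, o) :: g' = m.root then m else
      let ua : A → ℝ := fun a' => 1 - ∑ o', P.obsProb g' a' o' * (1 - m.U ((a', o') :: g'))
      let m₁ : Memory A Z :=
        { m with
          Ua := Function.update m.Ua g' ua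
          U := Function.update m.U g' (Finset.univ.inf' Finset.univ_nonempty ua) }
      if (a, o) :: g' ∈ m.srch then P.backup g' R m₁
      else
        let R' := R + P.rew g' a
        P.backup g' R'
          { m₁ with
            srch := insert ((a, o) :: g') m.srch
            cnt := Function.update m.cnt ((a, o) :: g') 1
            cntA := Function.update m.cntA ((a, o) :: g')
              (Function.update (m.cntA ((a, o) :: g')) a 1)
            val := Function.update m.val ((a, o) :: g')
              (Function.update (m.val ((a, o) :: g')) a R') }

open Classical in
/-- `UpdateTrees(h)`: add `h` and all its prefixes (from the root on) to the explicit tree, set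
`h.U ← 0`, then propagate to the root. -/
def updateTrees (P : POMDP S A Z) (h : Hist A Z) (m : Memory A Z) : Memory A Z :=
  P.backup h 0
    { m with
      exp := m.exp ∪ {g | m.root <:+ g ∧ g <:+ h}
      U := Function.update m.U h 0 }

open Classical in
/-- The end of a simulation at history `h` with accumulated discounted payoff `pay`. -/
def finish (P : POMDP S A Z) (h : Hist A Z) (pay : ℝ) (m : Memory A Z) : Memory A Z :=
  if m.thr ≤ pay then P.updateTrees h m else m

/-! ### The procedures `Rollout` and `Simulate`

They return the new memory and the simulated payoff; the recursion is on `depth`, and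
`γ ^ (m.n - depth)` is the discount of the current step. -/

/-- `Rollout(s, h, depth, pay)`. -/
def rollout (P : POMDP S A Z) (γ : ℝ) :
    ℕ → S → Hist A Z → ℝ → Memory A Z → PMF (Memory A Z × ℝ)
  | 0, _, h, pay, m => PMF.pure (P.finish h pay m, 0)
  | d + 1, s, h, pay, m =>
      (PMF.uniformOfFintype A).bind fun a =>
      (P.trans s a).bind fun s' => (P.obs s').bind fun o =>
        (P.rollout γ d s' ((a, o) :: h) (pay + γ ^ (m.n - (d + 1)) * P.reward s a) m).map
          fun x => (x.1, P.reward s a + γ * x.2)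

/-- `h.V_a + K √(log h.N / h.N_a)`, which is `+∞` for an action that was never tried. -/
def score (K : ℝ) (m : Memory A Z) (h : Hist A Z) (a : A) : EReal :=
  if m.cntA h a = 0 then ⊤
  else ((m.val h a + K * Real.sqrt (Real.log (m.cnt h) / m.cntA h a) : ℝ) : EReal)

open Classical in
/-- The set of the actions of maximal score. -/
def bestActions (K : ℝ) (m : Memory A Z) (h : Hist A Z) : Finset A :=
  Finset.univ.filter fun a => ∀ b, score K m h b ≤ score K m h a

open Classical in
/-- `(h.N, h.N_a) ← (h.N + 1, h.N_a + 1)`, then `h.V_a ← h.V_a + (R - h.V_a) / h.N_a`. -/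
def recordVisit (h : Hist A Z) (a : A) (R : ℝ) (m : Memory A Z) : Memory A Z :=
  { m with
    cnt := Function.update m.cnt h (m.cnt h + 1)
    cntA := Function.update m.cntA h (Function.update (m.cntA h) a (m.cntA h a + 1))
    val := Function.update m.val h (Function.update (m.val h) a
      (m.val h a + (R - m.val h a) / ((m.cntA h a + 1 : ℕ) : ℝ))) }

open Classical in
/-- `Simulate(s, h, depth, pay)`, with exploration constant `K`. The maximizing action is drawn
from the set `F` of all maximizing actions according to `tie F`. -/
def simulate (P : POMDP S A Z) (γ K : ℝ) (tie : Finset A → PMF A) :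
    ℕ → S → Hist A Z → ℝ → Memory A Z → PMF (Memory A Z × ℝ)
  | 0, _, h, pay, m => PMF.pure (P.finish h pay m, 0)
  | d + 1, s, h, pay, m =>
      if h ∉ m.srch then P.rollout γ (d + 1) s h pay { m with srch := insert h m.srch }
      else
        (tie (bestActions K m h)).bind fun a =>
        (P.trans s a).bind fun s' => (P.obs s').bind fun o =>
          (P.simulate γ K tie d s' ((a, o) :: h)
            (pay + γ ^ (m.n - (d + 1)) * P.reward s a) m).map
              fun x =>
                (recordVisit h a (P.reward s a + γ * x.2) x.1, P.reward s a + γ * x.2)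

/-! ### The main loop -/

/-- One pass of the search loop: sample a state from the belief at the root and simulate. -/
def simCall (P : POMDP S A Z) (γ K : ℝ) (tie : Finset A → PMF A) (m : Memory A Z) :
    PMF (Memory A Z) :=
  (P.belief m.root).bind fun s => (P.simulate γ K tie m.n s m.root 0 m).map Prod.fst

/-- `Explore` with a timeout of `T` calls of `Simulate`: the law of the list of the `T + 1` memory
contents after `T`, `T - 1`, …, `0` calls (so the final memory comes first). -/
def explore (P : POMDP S A Z) (γ K : ℝ) (tie : Finset A → PMF A) :
    ℕ → Memory A Z → PMF (List (Memory A Z))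
  | 0, m => PMF.pure [m]
  | T + 1, m => (P.explore γ K tie T m).bind fun l =>
      (P.simCall γ K tie (l.headD m)).map fun m' => m' :: l

/-- The memory after `PlayAction` has played `a` and received observation `o` and reward `R`, where
`d` is the risk vector of `a`, together with `n ← n - 1`. Both trees are cut down to the subtree of
the new root, which consists of the new root alone if that was not yet a node. -/
def afterPlay (γ : ℝ) (a : A) (d : Z → ℝ) (o : Z) (R : ℝ) (m : Memory A Z) : Memory A Z :=
  { m with
    root := (a, o) :: m.root
    n := m.n - 1
    thr := (m.thr - R) / γ
    rbound := d o
    srch := insert ((a, o) :: m.root) {g ∈ m.srch | (a, o) :: m.root <:+ g}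
    exp := insert ((a, o) :: m.root) {g ∈ m.exp | (a, o) :: m.root <:+ g} }

/-- Action selection and play. The rule `select` produces, from the memory, the (random) action `a`
and its risk vector; the actual POMDP is in the hidden state `c.2`. -/
def selectPlay (P : POMDP S A Z) (γ : ℝ) (select : Memory A Z → PMF (A × (Z → ℝ)))
    (c : Memory A Z × S) : PMF (Memory A Z × S) :=
  (select c.1).bind fun x => (P.trans c.2 x.1).bind fun s' => (P.obs s').map fun o =>
    (afterPlay γ x.1 x.2 o (P.reward c.2 x.1) c.1, s')

/-- The initial memory. -/
def initMemory (N : ℕ) (τ α : ℝ) : Memory A Z where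
  root := []
  n := N
  thr := τ
  rbound := α
  srch := {[]}
  exp := {[]}
  cnt := fun _ => 0
  cntA := fun _ _ => 0
  val := fun _ _ => 0
  U := fun _ => 1
  Ua := fun _ _ => 1

/-- The memory and the hidden state of the actual POMDP at the points of the executions of RAMCP,
for arbitrary lengths of the search phases. -/
inductive Reachable (P : POMDP S A Z) (γ K : ℝ) (tie : Finset A → PMF A)
    (select : Memory A Z → PMF (A × (Z → ℝ))) (N : ℕ) (τ α : ℝ) : Memory A Z × S → Prop
  | start (s : S) (hs : s ∈ P.init.support) :
      Reachable P γ K tie select N τ α (initMemory N τ α, s)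
  | sim (m m' : Memory A Z) (s : S) (h : Reachable P γ K tie select N τ α (m, s)) (hn : 0 < m.n)
      (hm : m' ∈ (P.simCall γ K tie m).support) : Reachable P γ K tie select N τ α (m', s)
  | play (c c' : Memory A Z × S) (h : Reachable P γ K tie select N τ α c) (hn : 0 < c.1.n)
      (hc : c' ∈ (P.selectPlay γ select c).support) : Reachable P γ K tie select N τ α c'

/-- The law of the memory and the hidden state at the start of search phase number `k` (from `0`)
in an execution in which every search phase has the timeout `T`; meaningful for `k ≤ N`. -/
def phaseStart (P : POMDP S A Z) (γ K : ℝ) (tie : Finset A → PMF A)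
    (select : Memory A Z → PMF (A × (Z → ℝ))) (N : ℕ) (τ α : ℝ) (T : ℕ) :
    ℕ → PMF (Memory A Z × S)
  | 0 => P.init.map fun s => (initMemory N τ α, s)
  | k + 1 => (P.phaseStart γ K tie select N τ α T k).bind fun c =>
      (P.explore γ K tie T c.1).bind fun l => P.selectPlay γ select (l.headD c.1, c.2)

/-- The `U`-attribute of the root equals the minimal achievable risk at the root. -/
def RootOptimal (P : POMDP S A Z) (γ : ℝ) (N : ℕ) (m : Memory A Z) : Prop :=
  m.U m.root = P.minRisk γ (P.belief m.root) (N - m.root.length) m.thr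

end POMDP

end

/-! Observable rewards make the payoff collected along a history a function of that history. The
risk is therefore governed by the residual threshold `residual`, updated by `t ↦ (t - rew) / γ`: a
play of full length succeeds exactly when the residual threshold at its leaf is `≤ 0`. The hidden
state can be integrated out of both the play and the simulations, and the minimal risk is computed
by backward induction over histories (`minRisk_eq_optRisk`).

Soundness. After every completed call, `U` is the backward induction value for its own leaf values.
A leaf value is `1`, or it is `0` at a successful leaf. By monotonicity `U` dominates the optimal
risk, and the two agree at the root once every successful leaf below it has been found.

Convergence. There are finitely many leaves, so it suffices that each successful one is found with
probability tending to `1`. Simulated returns are bounded, hence the logarithmic exploration term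
prevents an action from being starved: the visits of one action are bounded in terms of the visits
of any other (`succ_cntA_le_visitBound`). It remains to pass from "`a` is tried often at `g`" to
"the child `gao` is reached often". Let `Ψ` measure the failure to explore the child, never
increasing and at least halved by each visit. A trial of `a` multiplies `Ψ` on average by at most
some `κ < 1`, so `κ ^ (-(g.N_a - 1)) * Ψ` has nonincreasing expectation
(`expect_beliefSimulate_potential_le`). Markov's inequality then makes `Ψ` small in probability, and
induction along the history reaches the leaves.

This potential does not increase when an action is played either. Its expectation in a later search
phase is thus bounded by its initial value, uniformly in the timeout, although the memory at the
start of that phase depends on the timeout. -/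

noncomputable section

open scoped ENNReal

set_option linter.unusedSectionVars false

/-! ### Expectations under discrete laws -/

namespace PMF

variable {α β : Type*}

/-- The expectation of an extended nonnegative function under a discrete law. -/
def expect (p : PMF α) (f : α → ℝ≥0∞) : ℝ≥0∞ := ∑' x, p x * f x

theorem expect_bind (p : PMF α) (q : α → PMF β) (f : β → ℝ≥0∞) :
    (p.bind q).expect f = p.expect fun a => (q a).expect f := by
  simp only [expect, bind_apply, ← ENNReal.tsum_mul_right, ← ENNReal.tsum_mul_left]
  rw [ENNReal.tsum_comm]
  simp only [mul_assoc]

theorem expect_pure (a : α) (f : α → ℝ≥0∞) : (pure a).expect f = f a := by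
  rw [expect, tsum_eq_single a]
  · simp
  · intro b hb
    simp [hb]

theorem expect_map (p : PMF α) (g : α → β) (f : β → ℝ≥0∞) :
    (p.map g).expect f = p.expect fun a => f (g a) := by
  rw [← bind_pure_comp, expect_bind]
  simp [expect_pure]

theorem expect_mono (p : PMF α) {f g : α → ℝ≥0∞} (h : ∀ x ∈ p.support, f x ≤ g x) :
    p.expect f ≤ p.expect g := by
  refine ENNReal.tsum_le_tsum fun x => ?_
  by_cases hx : x ∈ p.support
  · gcongr
    exact h x hx
  · simp [(p.apply_eq_zero_iff x).2 hx]

theorem expect_const (p : PMF α) (c : ℝ≥0∞) : p.expect (fun _ => c) = c := by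
  simp [expect, ENNReal.tsum_mul_right]

theorem expect_mul_const (p : PMF α) (f : α → ℝ≥0∞) (c : ℝ≥0∞) :
    p.expect (fun x => f x * c) = p.expect f * c := by
  simp only [expect, ← ENNReal.tsum_mul_right, mul_assoc]

theorem expect_le (p : PMF α) {f : α → ℝ≥0∞} {c : ℝ≥0∞} (h : ∀ x ∈ p.support, f x ≤ c) :
    p.expect f ≤ c :=
  (p.expect_mono h).trans_eq (p.expect_const c)

theorem mul_toOuterMeasure_le_expect (p : PMF α) (f : α → ℝ≥0∞) (c : ℝ≥0∞) :
    c * p.toOuterMeasure {x | c ≤ f x} ≤ p.expect f := by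
  rw [toOuterMeasure_apply, ← ENNReal.tsum_mul_left]
  refine ENNReal.tsum_le_tsum fun x => ?_
  by_cases hx : c ≤ f x
  · rw [Set.indicator_of_mem (by exact hx), mul_comm]
    gcongr
  · rw [Set.indicator_of_notMem (by exact hx)]
    simp

theorem bind_congr (p : PMF α) {f g : α → PMF β} (h : ∀ x ∈ p.support, f x = g x) :
    p.bind f = p.bind g := by
  ext b
  simp only [bind_apply]
  refine tsum_congr fun x => ?_
  by_cases hx : x ∈ p.support
  · rw [h x hx]
  · simp [(p.apply_eq_zero_iff x).2 hx]

theorem toOuterMeasure_le_one (p : PMF α) (s : Set α) : p.toOuterMeasure s ≤ 1 := by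
  rw [toOuterMeasure_apply, ← p.tsum_coe]
  exact ENNReal.tsum_le_tsum fun x => Set.indicator_le_self s p x

theorem one_le_toOuterMeasure_add_compl (p : PMF α) (s : Set α) :
    1 ≤ p.toOuterMeasure s + p.toOuterMeasure sᶜ := by
  have h : p.toOuterMeasure Set.univ = 1 := by
    simp [toOuterMeasure_apply_eq_one_iff]
  rw [← h, ← Set.union_compl_self s]
  exact MeasureTheory.measure_union_le s sᶜ

end PMF

/-! ### Disintegration of a step along the observation -/

namespace POMDP

variable {S A Z : Type*} [Fintype S] [Fintype A] [Fintype Z] [Nonempty A]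

/-- The law of the observation received when `a` is played after the history `h`. -/
def obsPMF (P : POMDP S A Z) (h : Hist A Z) (a : A) : PMF Z :=
  (P.joint (P.belief h) a).map Prod.snd

/-- Bayes' rule: the joint law of state and observation is the observation law followed by the
updated belief. -/
theorem bind_joint (P : POMDP S A Z) {β : Type*} (b : PMF S) (a : A) (L : S → Z → PMF β) :
    (P.joint b a).bind (fun x => L x.1 x.2) =
      ((P.joint b a).map Prod.snd).bind fun o => (P.updateBelief b a o).bind fun s => L s o := by
  classical
  set p := P.joint b a with hp
  have hmap : ∀ o, p.map Prod.snd o = ∑' x, ({x : S × Z | x.2 = o} : Set _).indicator p x := by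
    intro o
    rw [← PMF.toOuterMeasure_apply, ← PMF.toOuterMeasure_apply_singleton,
      PMF.toOuterMeasure_map_apply]
    rfl
  have key : ∀ s o, p.map Prod.snd o * P.updateBelief b a o s = p (s, o) := by
    intro s o
    rw [updateBelief]
    split_ifs with h
    · have h0 : p.map Prod.snd o ≠ 0 := by
        obtain ⟨x, hx, hxs⟩ := h
        rw [← PMF.mem_support_iff, PMF.mem_support_map_iff]
        exact ⟨x, hxs, hx⟩
      have e : ((P.joint b a).filter {x | x.2 = o} h).map Prod.fst s =
          (P.joint b a).filter {x | x.2 = o} h (s, o) := by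
        rw [PMF.map_apply, tsum_eq_single (s, o)]
        · rw [if_pos rfl]
        · rintro ⟨s', o'⟩ hne
          split_ifs with hs
          · rw [PMF.filter_apply_eq_zero_of_notMem]
            rintro rfl
            exact hne (by simp_all)
          · rfl
      rw [e, PMF.filter_apply, ← hp, ← hmap, Set.indicator_of_mem (by simp), mul_comm,
        mul_assoc, ENNReal.inv_mul_cancel h0 (PMF.apply_ne_top _ _), mul_one]
    · push Not at h
      -- For an impossible observation the default value of `updateBelief` is irrelevant, since it
      -- carries weight zero.
      have h0 : p (s, o) = 0 := (p.apply_eq_zero_iff _).2 (h (s, o) rfl)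
      have h1 : p.map Prod.snd o = 0 := by
        rw [PMF.apply_eq_zero_iff, PMF.mem_support_map_iff]
        rintro ⟨x, hx, hxo⟩
        exact h x hxo hx
      rw [h0, h1, zero_mul]
  ext y
  simp only [PMF.bind_apply]
  rw [ENNReal.tsum_prod', ENNReal.tsum_comm]
  refine tsum_congr fun o => ?_
  rw [← ENNReal.tsum_mul_left]
  refine tsum_congr fun s => ?_
  rw [← mul_assoc, key]

/-- One step of a play from the belief `b_h`, when the continuation depends on the current state
only through data determined by the history. -/
theorem belief_bind_step (P : POMDP S A Z) {β : Type*} (h : Hist A Z) (q : PMF A)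
    (F : S → A → S → Z → PMF β) (G : A → Z → S → PMF β)
    (hFG : ∀ s ∈ (P.belief h).support, ∀ a s' o, F s a s' o = G a o s') :
    ((P.belief h).bind fun s => q.bind fun a => (P.trans s a).bind fun s' =>
        (P.obs s').bind fun o => F s a s' o) =
      q.bind fun a => (P.obsPMF h a).bind fun o => (P.belief ((a, o) :: h)).bind fun s' =>
        G a o s' := by
  rw [PMF.bind_congr _ (g := fun s => q.bind fun a => (P.trans s a).bind fun s' =>
    (P.obs s').bind fun o => G a o s') (fun s hs => by simp only [hFG s hs]), PMF.bind_comm]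
  congr 1
  funext a
  refine Eq.trans ?_ (P.bind_joint (P.belief h) a fun s' o => G a o s')
  simp only [joint, PMF.bind_bind, PMF.bind_map, Function.comp_def]

theorem obsProb_eq (P : POMDP S A Z) (h : Hist A Z) (a : A) (o : Z) :
    P.obsProb h a o = (P.obsPMF h a o).toReal := by
  classical
  rw [obsPMF, joint, PMF.map_bind, PMF.bind_apply, tsum_fintype, ENNReal.toReal_sum]
  · rw [obsProb]
    refine Finset.sum_congr rfl fun s _ => ?_
    rw [PMF.map_bind, PMF.bind_apply, tsum_fintype, ENNReal.toReal_mul, ENNReal.toReal_sum,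
      Finset.mul_sum]
    · refine Finset.sum_congr rfl fun s' _ => ?_
      rw [ENNReal.toReal_mul, mul_assoc]
      congr 3
      rw [PMF.map_comp]
      exact congrFun (congrArg DFunLike.coe (PMF.map_id (P.obs s')).symm) o
    · exact fun s' _ => ENNReal.mul_ne_top (PMF.apply_ne_top _ _) (PMF.apply_ne_top _ _)
  · exact fun s _ => ENNReal.mul_ne_top (PMF.apply_ne_top _ _) (PMF.apply_ne_top _ _)

theorem obsProb_pos_iff (P : POMDP S A Z) (h : Hist A Z) (a : A) (o : Z) :
    0 < P.obsProb h a o ↔ o ∈ (P.obsPMF h a).support := by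
  rw [obsProb_eq, ENNReal.toReal_pos_iff, PMF.apply_pos_iff]
  simp [PMF.apply_lt_top]

theorem obsProb_nonneg (P : POMDP S A Z) (h : Hist A Z) (a : A) (o : Z) :
    0 ≤ P.obsProb h a o := by
  rw [obsProb_eq]
  exact ENNReal.toReal_nonneg

theorem _root_.PMF.sum_toReal {α : Type*} [Fintype α] (p : PMF α) : ∑ x, (p x).toReal = 1 := by
  rw [← ENNReal.toReal_sum fun x _ => p.apply_ne_top x, ← tsum_fintype (L := .unconditional _),
    p.tsum_coe, ENNReal.toReal_one]

theorem sum_obsProb (P : POMDP S A Z) (h : Hist A Z) (a : A) : ∑ o, P.obsProb h a o = 1 := by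
  simp only [obsProb_eq]
  exact PMF.sum_toReal _

theorem rew_eq {P : POMDP S A Z} (hP : P.ObservableRewards) {h : Hist A Z} (hh : P.IsHistory h)
    {s : S} (hs : s ∈ (P.belief h).support) (a : A) : P.reward s a = P.rew h a :=
  hP h hh s hs _ (P.belief h).support_nonempty.some_mem a

theorem isHistory_cons {P : POMDP S A Z} {h : Hist A Z} (hh : P.IsHistory h) {a : A} {o : Z}
    (ho : o ∈ (P.obsPMF h a).support) : P.IsHistory ((a, o) :: h) :=
  ⟨hh, (P.obsProb_pos_iff h a o).2 ho⟩

theorem mem_support_obsPMF_and_belief {P : POMDP S A Z} {h : Hist A Z} {s s' : S} {a : A} {o : Z}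
    (hs : s ∈ (P.belief h).support) (hs' : s' ∈ (P.trans s a).support)
    (ho : o ∈ (P.obs s').support) :
    o ∈ (P.obsPMF h a).support ∧ s' ∈ (P.belief ((a, o) :: h)).support := by
  have hj : (s', o) ∈ (P.joint (P.belief h) a).support := by
    rw [joint, PMF.mem_support_bind_iff]
    refine ⟨s, hs, ?_⟩
    rw [PMF.mem_support_bind_iff]
    refine ⟨s', hs', ?_⟩
    rw [PMF.mem_support_map_iff]
    exact ⟨o, ho, rfl⟩
  refine ⟨(PMF.mem_support_map_iff _ _ _).2 ⟨_, hj, rfl⟩, ?_⟩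
  rw [belief, updateBelief, dif_pos ⟨(s', o), rfl, hj⟩, PMF.mem_support_map_iff]
  exact ⟨(s', o), (PMF.mem_support_filter_iff _).2 ⟨rfl, hj⟩, rfl⟩

end POMDP

/-! ### Minimal risk by backward induction -/

namespace POMDP

variable {S A Z : Type*} [Fintype S] [Fintype A] [Fintype Z] [Nonempty A]

/-- The threshold that remains after the history `h`, when the initial threshold is `τ`. -/
def residual (P : POMDP S A Z) (γ τ : ℝ) : Hist A Z → ℝ
  | [] => τ
  | (a, _) :: h => (P.residual γ τ h - P.rew h a) / γ

/-- The risk bound of the action `a` computed from the risk bounds of the children. -/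
def actionBound (P : POMDP S A Z) (U : Hist A Z → ℝ) (h : Hist A Z) (a : A) : ℝ :=
  1 - ∑ o, P.obsProb h a o * (1 - U ((a, o) :: h))

/-- The risk bound of a node computed from the risk bounds of its children. -/
def nodeBound (P : POMDP S A Z) (U : Hist A Z → ℝ) (h : Hist A Z) : ℝ :=
  Finset.univ.inf' Finset.univ_nonempty (P.actionBound U h)

theorem actionBound_eq (P : POMDP S A Z) (U : Hist A Z → ℝ) (h : Hist A Z) (a : A) :
    P.actionBound U h a = ∑ o, P.obsProb h a o * U ((a, o) :: h) := by
  simp only [actionBound, mul_sub, mul_one, Finset.sum_sub_distrib, P.sum_obsProb]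
  ring

theorem actionBound_mono (P : POMDP S A Z) {U U' : Hist A Z → ℝ} {h : Hist A Z} {a : A}
    (hU : ∀ o ∈ (P.obsPMF h a).support, U ((a, o) :: h) ≤ U' ((a, o) :: h)) :
    P.actionBound U h a ≤ P.actionBound U' h a := by
  simp only [actionBound_eq]
  refine Finset.sum_le_sum fun o _ => ?_
  rcases (P.obsProb_nonneg h a o).eq_or_lt with h0 | h0
  · simp [← h0]
  · exact mul_le_mul_of_nonneg_left (hU o ((P.obsProb_pos_iff h a o).1 h0)) h0.le

theorem nodeBound_mono (P : POMDP S A Z) {U U' : Hist A Z → ℝ} {h : Hist A Z}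
    (hU : ∀ a, ∀ o ∈ (P.obsPMF h a).support, U ((a, o) :: h) ≤ U' ((a, o) :: h)) :
    P.nodeBound U h ≤ P.nodeBound U' h :=
  Finset.inf'_mono_fun fun a _ => P.actionBound_mono (hU a)

/-- The minimal risk after the history `h` with `n` steps to go, by backward induction. -/
def optRisk (P : POMDP S A Z) (γ τ : ℝ) : ℕ → Hist A Z → ℝ
  | 0, h => if 0 < P.residual γ τ h then 1 else 0
  | n + 1, h => P.nodeBound (P.optRisk γ τ n) h

/-- The risk of the policy `σ` after the history `g`; the second history is what `σ` has seen. -/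
def polRisk (P : POMDP S A Z) (γ τ : ℝ) (σ : Policy A Z) : ℕ → Hist A Z → Hist A Z → ℝ
  | 0, g, _ => if 0 < P.residual γ τ g then 1 else 0
  | n + 1, g, h =>
      ∑ a, (σ h a).toReal * ∑ o, P.obsProb g a o * P.polRisk γ τ σ n ((a, o) :: g) ((a, o) :: h)

/-- The law of the discounted payoff after the history `g`. -/
def payoffLaw (P : POMDP S A Z) (γ : ℝ) (σ : Policy A Z) : ℕ → Hist A Z → Hist A Z → PMF ℝ
  | 0, _, _ => PMF.pure 0
  | n + 1, g, h => (σ h).bind fun a => (P.obsPMF g a).bind fun o =>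
      (P.payoffLaw γ σ n ((a, o) :: g) ((a, o) :: h)).map fun x => P.rew g a + γ * x

/-- The reward of each step depends on the history alone, so averaging over the current belief
leaves a process driven only by actions and observations. -/
theorem belief_bind_playLaw {P : POMDP S A Z} (hP : P.ObservableRewards) (γ : ℝ)
    (σ : Policy A Z) (n : ℕ) : ∀ g h : Hist A Z, P.IsHistory g →
    ((P.belief g).bind fun s => (P.playLaw σ n h s).map (P.disc γ)) = P.payoffLaw γ σ n g h := by
  induction n with
  | zero =>
    intro g h _
    simp [playLaw, payoffLaw, PMF.pure_map, disc]
  | succ n ih =>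
    intro g h hg
    simp only [playLaw, PMF.map_bind, PMF.map_comp]
    rw [P.belief_bind_step g (σ h) _ (fun a o s' => ((P.playLaw σ n ((a, o) :: h) s').map
      (P.disc γ)).map fun x => P.rew g a + γ * x)]
    · rw [payoffLaw]
      congr 1
      funext a
      refine PMF.bind_congr _ fun o ho => ?_
      rw [← PMF.map_bind, ih _ _ (isHistory_cons hg ho)]
    · intro s hs a s' o
      rw [PMF.map_comp, ← rew_eq hP hg hs]
      rfl

theorem toReal_toOuterMeasure_bind {α β : Type*} [Fintype α] (p : PMF α) (q : α → PMF β)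
    (s : Set β) : ((p.bind q).toOuterMeasure s).toReal =
      ∑ x, (p x).toReal * ((q x).toOuterMeasure s).toReal := by
  rw [PMF.toOuterMeasure_bind_apply, tsum_fintype, ENNReal.toReal_sum]
  · simp [ENNReal.toReal_mul]
  · exact fun x _ => ENNReal.mul_ne_top (p.apply_ne_top x)
      (((q x).toOuterMeasure_le_one s).trans_lt ENNReal.one_lt_top).ne

/-- The event `rew + γ x < t` is `x < (t - rew) / γ`, which is the event for the residual threshold
one step later. -/
theorem toReal_payoffLaw (P : POMDP S A Z) {γ : ℝ} (hγ : 0 < γ) (τ : ℝ) (σ : Policy A Z) (n : ℕ) :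
    ∀ g h : Hist A Z, ((P.payoffLaw γ σ n g h).toOuterMeasure
      {x | x < P.residual γ τ g}).toReal = P.polRisk γ τ σ n g h := by
  induction n with
  | zero =>
    intro g h
    simp only [payoffLaw, polRisk, PMF.toOuterMeasure_pure_apply, Set.mem_ofPred_eq]
    split_ifs <;> simp
  | succ n ih =>
    intro g h
    simp only [payoffLaw, polRisk, toReal_toOuterMeasure_bind, obsProb_eq,
      PMF.toOuterMeasure_map_apply, ← ih, residual, Set.preimage_ofPred_eq]
    refine Finset.sum_congr rfl fun a _ => ?_
    congr 1
    refine Finset.sum_congr rfl fun o _ => ?_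
    congr 4
    ext x
    rw [lt_div_iff₀ hγ]
    constructor <;> intro h <;> linarith

theorem risk_eq_polRisk {P : POMDP S A Z} (hP : P.ObservableRewards) {γ : ℝ} (hγ : 0 < γ) (τ : ℝ)
    (σ : Policy A Z) (n : ℕ) {g : Hist A Z} (hg : P.IsHistory g) :
    P.risk γ σ (P.belief g) n (P.residual γ τ g) = P.polRisk γ τ σ n g [] := by
  rw [← P.toReal_payoffLaw hγ, ← belief_bind_playLaw hP γ σ n g [] hg, ← PMF.map_bind,
    PMF.toOuterMeasure_map_apply]
  rfl

theorem optRisk_le_polRisk (P : POMDP S A Z) (γ τ : ℝ) (σ : Policy A Z) (n : ℕ) :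
    ∀ g h : Hist A Z, P.optRisk γ τ n g ≤ P.polRisk γ τ σ n g h := by
  induction n with
  | zero => exact fun _ _ => le_rfl
  | succ n ih =>
    intro g h
    rw [optRisk, polRisk, ← one_mul (P.nodeBound _ _), ← (σ h).sum_toReal, Finset.sum_mul]
    refine Finset.sum_le_sum fun a _ => mul_le_mul_of_nonneg_left ?_ ENNReal.toReal_nonneg
    refine (Finset.inf'_le _ (Finset.mem_univ a)).trans ?_
    rw [actionBound_eq]
    exact Finset.sum_le_sum fun o _ => mul_le_mul_of_nonneg_left (ih _ _) (P.obsProb_nonneg _ _ _)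

theorem exists_polRisk_eq_optRisk (P : POMDP S A Z) (γ τ : ℝ) (N : ℕ) (g : Hist A Z) :
    ∃ σ : Policy A Z, P.polRisk γ τ σ N g [] = P.optRisk γ τ N g := by
  choose act hact using fun (n : ℕ) (h : Hist A Z) =>
    Finset.exists_mem_eq_inf' Finset.univ_nonempty (P.actionBound (P.optRisk γ τ n) h)
  -- The greedy policy sees only the history `h` since `g`. With `N - h.length` steps to go, its
  -- choice minimizes the bound for one step fewer, hence the `- 1`.
  let σ : Policy A Z := fun h => PMF.pure (act (N - h.length - 1) (h ++ g))
  refine ⟨σ, ?_⟩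
  suffices H : ∀ n (h : Hist A Z), n + h.length = N →
      P.polRisk γ τ σ n (h ++ g) h = P.optRisk γ τ n (h ++ g) from H N [] (by simp)
  intro n
  induction n with
  | zero => exact fun _ _ => rfl
  | succ n ih =>
    intro h hn
    have hσ : σ h = PMF.pure (act n (h ++ g)) := by
      simp only [σ]
      rw [show N - h.length - 1 = n by omega]
    rw [polRisk, hσ, Finset.sum_eq_single (act n (h ++ g)), PMF.pure_apply_self,
      ENNReal.toReal_one, one_mul, optRisk, nodeBound, (hact n (h ++ g)).2, actionBound_eq]
    · exact Finset.sum_congr rfl fun o _ => by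
        rw [← List.cons_append, ← ih ((act n (h ++ g), o) :: h) (by simp; omega)]
    · intro b _ hb
      rw [PMF.pure_apply_of_ne _ _ hb]
      simp
    · simp

theorem exists_risk_eq_optRisk {P : POMDP S A Z} (hP : P.ObservableRewards) {γ : ℝ} (hγ : 0 < γ)
    (τ : ℝ) (n : ℕ) {g : Hist A Z} (hg : P.IsHistory g) :
    ∃ σ : Policy A Z, P.risk γ σ (P.belief g) n (P.residual γ τ g) = P.optRisk γ τ n g := by
  obtain ⟨σ, hσ⟩ := P.exists_polRisk_eq_optRisk γ τ n g
  exact ⟨σ, (risk_eq_polRisk hP hγ τ σ n hg).trans hσ⟩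

theorem minRisk_eq_optRisk {P : POMDP S A Z} (hP : P.ObservableRewards) {γ : ℝ} (hγ : 0 < γ)
    (τ : ℝ) (n : ℕ) {g : Hist A Z} (hg : P.IsHistory g) :
    P.minRisk γ (P.belief g) n (P.residual γ τ g) = P.optRisk γ τ n g := by
  have hle : ∀ σ, P.optRisk γ τ n g ≤ P.risk γ σ (P.belief g) n (P.residual γ τ g) := fun σ => by
    rw [risk_eq_polRisk hP hγ τ σ n hg]
    exact P.optRisk_le_polRisk γ τ σ n g []
  obtain ⟨σ, hσ⟩ := exists_risk_eq_optRisk hP hγ τ n hg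
  have : Nonempty (Policy A Z) := ⟨σ⟩
  exact le_antisymm ((ciInf_le ⟨_, Set.forall_mem_range.2 hle⟩ σ).trans hσ.le) (le_ciInf hle)

end POMDP

/-! ### Simulations with the hidden state integrated out -/

namespace POMDP

variable {S A Z : Type*} [Fintype S] [Fintype A] [Fintype Z] [Nonempty A]

open Classical in
/-- The end of a simulation, decided by the remaining threshold instead of the payoff. -/
def beliefFinish (P : POMDP S A Z) (γ τ : ℝ) (h : Hist A Z) (m : Memory A Z) : Memory A Z :=
  if P.residual γ τ h ≤ 0 then P.updateTrees h m else m

/-- `Rollout` with the hidden state integrated out. -/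
def beliefRollout (P : POMDP S A Z) (γ τ : ℝ) :
    ℕ → Hist A Z → Memory A Z → PMF (Memory A Z × ℝ)
  | 0, h, m => PMF.pure (P.beliefFinish γ τ h m, 0)
  | d + 1, h, m => (PMF.uniformOfFintype A).bind fun a => (P.obsPMF h a).bind fun o =>
      (P.beliefRollout γ τ d ((a, o) :: h) m).map fun x => (x.1, P.rew h a + γ * x.2)

open Classical in
/-- `Simulate` with the hidden state integrated out. -/
def beliefSimulate (P : POMDP S A Z) (γ τ K : ℝ) (tie : Finset A → PMF A) :
    ℕ → Hist A Z → Memory A Z → PMF (Memory A Z × ℝ)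
  | 0, h, m => PMF.pure (P.beliefFinish γ τ h m, 0)
  | d + 1, h, m =>
      if h ∉ m.srch then P.beliefRollout γ τ (d + 1) h { m with srch := insert h m.srch }
      else (tie (bestActions K m h)).bind fun a => (P.obsPMF h a).bind fun o =>
        (P.beliefSimulate γ τ K tie d ((a, o) :: h) m).map fun x =>
          (recordVisit h a (P.rew h a + γ * x.2) x.1, P.rew h a + γ * x.2)

theorem finish_eq_beliefFinish (P : POMDP S A Z) {γ τ pay : ℝ} {h : Hist A Z}
    {m : Memory A Z} {k : ℕ} (hγ : 0 < γ) (hpay : m.thr - pay = γ ^ k * P.residual γ τ h) :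
    P.finish h pay m = P.beliefFinish γ τ h m := by
  have hk : 0 < γ ^ k := pow_pos hγ k
  have : m.thr ≤ pay ↔ P.residual γ τ h ≤ 0 := by
    rw [← sub_nonpos, hpay]
    constructor
    · intro h0
      by_contra! h1
      exact absurd (mul_pos hk h1) h0.not_gt
    · exact fun h0 => mul_nonpos_of_nonneg_of_nonpos hk.le h0
  simp only [finish, beliefFinish, this]

/-- This propagates the invariant `thr - pay = γ ^ (n - d) * residual`, which at depth `0` turns the
test on the payoff into a test on the leaf. -/
theorem residual_step (P : POMDP S A Z) {γ τ pay thr : ℝ} {h : Hist A Z} {n d : ℕ} (hγ : 0 < γ)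
    (hd : d + 1 ≤ n) (hpay : thr - pay = γ ^ (n - (d + 1)) * P.residual γ τ h) (a : A) (o : Z) :
    thr - (pay + γ ^ (n - (d + 1)) * P.rew h a) =
      γ ^ (n - d) * P.residual γ τ ((a, o) :: h) := by
  rw [residual, show n - d = n - (d + 1) + 1 by omega, pow_succ, ← sub_sub, hpay]
  field_simp

theorem belief_bind_rollout {P : POMDP S A Z} (hP : P.ObservableRewards) {γ : ℝ} (hγ : 0 < γ)
    (τ : ℝ) (m : Memory A Z) (d : ℕ) : ∀ (h : Hist A Z) (pay : ℝ), P.IsHistory h → d ≤ m.n →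
    m.thr - pay = γ ^ (m.n - d) * P.residual γ τ h →
    ((P.belief h).bind fun s => P.rollout γ d s h pay m) = P.beliefRollout γ τ d h m := by
  induction d with
  | zero =>
    intro h pay _ _ hpay
    simp [rollout, beliefRollout, P.finish_eq_beliefFinish hγ hpay]
  | succ d ih =>
    intro h pay hh hd hpay
    simp only [rollout]
    rw [P.belief_bind_step h _ _ (fun a o s' => (P.rollout γ d s' ((a, o) :: h)
      (pay + γ ^ (m.n - (d + 1)) * P.rew h a) m).map fun x => (x.1, P.rew h a + γ * x.2))
      fun s hs a s' o => by rw [rew_eq hP hh hs], beliefRollout]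
    congr 1
    funext a
    refine PMF.bind_congr _ fun o ho => ?_
    rw [← PMF.map_bind, ih _ _ (isHistory_cons hh ho) (by omega) (P.residual_step hγ hd hpay a o)]

theorem belief_bind_simulate {P : POMDP S A Z} (hP : P.ObservableRewards) {γ : ℝ} (hγ : 0 < γ)
    (τ K : ℝ) (tie : Finset A → PMF A) (m : Memory A Z) (d : ℕ) :
    ∀ (h : Hist A Z) (pay : ℝ), P.IsHistory h → d ≤ m.n →
    m.thr - pay = γ ^ (m.n - d) * P.residual γ τ h →
    ((P.belief h).bind fun s => P.simulate γ K tie d s h pay m) =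
      P.beliefSimulate γ τ K tie d h m := by
  induction d with
  | zero =>
    intro h pay _ _ hpay
    simp [simulate, beliefSimulate, P.finish_eq_beliefFinish hγ hpay]
  | succ d ih =>
    intro h pay hh hd hpay
    rw [beliefSimulate]
    simp only [simulate]
    split_ifs with hmem
    swap
    · exact belief_bind_rollout hP hγ τ { m with srch := insert h m.srch } (d + 1) h pay hh hd hpay
    rw [P.belief_bind_step h (tie (bestActions K m h)) _ (fun a o s' => (P.simulate γ K tie d s' ((a, o) :: h)
      (pay + γ ^ (m.n - (d + 1)) * P.rew h a) m).map fun x =>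
        (recordVisit h a (P.rew h a + γ * x.2) x.1, P.rew h a + γ * x.2))
      fun s hs a s' o => by rw [rew_eq hP hh hs]]
    congr 1
    funext a
    refine PMF.bind_congr _ fun o ho => ?_
    rw [← PMF.map_bind, ih _ _ (isHistory_cons hh ho) (by omega) (P.residual_step hγ hd hpay a o)]

theorem simCall_eq {P : POMDP S A Z} (hP : P.ObservableRewards) {γ : ℝ} (hγ : 0 < γ)
    (τ K : ℝ) (tie : Finset A → PMF A) {m : Memory A Z} (hm : P.IsHistory m.root)
    (hthr : m.thr = P.residual γ τ m.root) :
    P.simCall γ K tie m = (P.beliefSimulate γ τ K tie m.n m.root m).map Prod.fst := by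
  rw [simCall, ← PMF.map_bind, belief_bind_simulate hP hγ τ K tie m m.n m.root 0 hm le_rfl]
  simp [hthr]

end POMDP

/-! ### Visit counts: invariants and admissible changes -/

/-- The largest number of visits of an action that is compatible with `c` visits of another one. -/
def visitBound (K B c : ℝ) : ℝ := 4 * c + Real.exp (16 * B ^ 2 * c / K ^ 2) + 1

theorem visitBound_mono (K B : ℝ) : Monotone (visitBound K B) := by
  intro c d h
  unfold visitBound
  have : 16 * B ^ 2 * c / K ^ 2 ≤ 16 * B ^ 2 * d / K ^ 2 := by gcongr
  have := Real.exp_le_exp.2 this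
  linarith

namespace Memory

variable {A Z : Type*}

section Counts

variable [Fintype A]

/-- The invariants of the visit counts and the values. -/
structure CountsValid (K B : ℝ) (m : Memory A Z) : Prop where
  root_mem : m.root ∈ m.srch
  zero : ∀ g, m.root <:+ g → g ∉ m.srch → m.cnt g = 0 ∧ ∀ a, m.cntA g a = 0
  sum : ∀ g, m.root <:+ g → m.cnt g = ∑ a, m.cntA g a
  balance : ∀ g, m.root <:+ g → ∀ a b, (m.cntA g b : ℝ) ≤ visitBound K B (m.cntA g a)
  val : ∀ g a, |m.val g a| ≤ B

end Counts

/-- The effect of `UpdateTrees`: nodes of the search tree are left alone, and new nodes may be added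
to it as if they had been visited once. -/
structure Extends (B : ℝ) (N : ℕ) (m m' : Memory A Z) : Prop where
  root : m'.root = m.root
  n : m'.n = m.n
  thr : m'.thr = m.thr
  srch : m.srch ⊆ m'.srch
  leaf : ∀ g, g.length = N → m.U g = 0 → m'.U g = 0
  node : ∀ g, (m'.cnt g = m.cnt g ∧ m'.cntA g = m.cntA g ∧ m'.val g = m.val g) ∨
    (g ∉ m.srch ∧ g ∈ m'.srch ∧ m'.cnt g = 1 ∧ ∃ a v, |v| ≤ B ∧
      (∀ b, b ≠ a → m'.cntA g b = m.cntA g b ∧ m'.val g b = m.val g b) ∧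
      m'.cntA g a = 1 ∧ m'.val g a = v)

/-- The effect of a simulation from a node of depth `k`. -/
structure Grows (N k : ℕ) (m m' : Memory A Z) : Prop where
  root : m'.root = m.root
  n : m'.n = m.n
  thr : m'.thr = m.thr
  srch : m.srch ⊆ m'.srch
  leaf : ∀ g, g.length = N → m.U g = 0 → m'.U g = 0
  cnt : ∀ g, m.root <:+ g → m.cnt g ≤ m'.cnt g
  old : ∀ g ∈ m.srch, g.length < k →
    m'.cnt g = m.cnt g ∧ m'.cntA g = m.cntA g ∧ m'.val g = m.val g
  cntA : ∀ g, m.root <:+ g → g.length < k → ∀ a, m'.cntA g a - 1 ≤ m.cntA g a - 1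

theorem Extends.refl (B : ℝ) (N : ℕ) (m : Memory A Z) : Extends B N m m where
  root := rfl
  n := rfl
  thr := rfl
  srch := subset_rfl
  leaf _ _ h := h
  node _ := Or.inl ⟨rfl, rfl, rfl⟩

theorem Extends.trans {B : ℝ} {N : ℕ} {m₁ m₂ m₃ : Memory A Z} (h : Extends B N m₁ m₂)
    (h' : Extends B N m₂ m₃) : Extends B N m₁ m₃ where
  root := h'.root.trans h.root
  n := h'.n.trans h.n
  thr := h'.thr.trans h.thr
  srch := h.srch.trans h'.srch
  leaf g hg h0 := h'.leaf g hg (h.leaf g hg h0)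
  node g := by
    rcases h.node g with ⟨h1, h2, h3⟩ | h1
    · rcases h'.node g with ⟨h4, h5, h6⟩ | ⟨h4, h5⟩
      · exact Or.inl ⟨h4.trans h1, h5.trans h2, h6.trans h3⟩
      · rw [h2, h3] at h5
        exact Or.inr ⟨fun hg => h4 (h.srch hg), h5⟩
    · rcases h'.node g with ⟨h4, h5, h6⟩ | ⟨h4, _⟩
      · rw [h4, h5, h6]
        exact Or.inr ⟨h1.1, h'.srch h1.2.1, h1.2.2⟩
      · exact absurd h1.2.1 h4

theorem Grows.trans {N k : ℕ} {m₁ m₂ m₃ : Memory A Z} (h : Grows N k m₁ m₂)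
    (h' : Grows N k m₂ m₃) : Grows N k m₁ m₃ where
  root := h'.root.trans h.root
  n := h'.n.trans h.n
  thr := h'.thr.trans h.thr
  srch := h.srch.trans h'.srch
  leaf g hg h0 := h'.leaf g hg (h.leaf g hg h0)
  cnt g hg := (h.cnt g hg).trans (h'.cnt g (h.root ▸ hg))
  old g hg hk := by
    obtain ⟨h1, h2, h3⟩ := h.old g hg hk
    obtain ⟨h4, h5, h6⟩ := h'.old g (h.srch hg) hk
    exact ⟨h4.trans h1, h5.trans h2, h6.trans h3⟩
  cntA g hg hk a := (h'.cntA g (h.root ▸ hg) hk a).trans (h.cntA g hg hk a)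

theorem Grows.mono {N k l : ℕ} {m m' : Memory A Z} (h : Grows N k m m') (hl : l ≤ k) :
    Grows N l m m' :=
  { h with
    old := fun g hg hk => h.old g hg (hk.trans_le hl)
    cntA := fun g hg hk => h.cntA g hg (hk.trans_le hl) }

section Counts

variable [Fintype A]

/-- A node inserted by `UpdateTrees` is credited with one visit that involved no sampled
observation. The truncated `- 1` in `Grows.cntA` makes this credit invisible. -/
theorem Extends.grows {K B : ℝ} {N : ℕ} {m m' : Memory A Z} (h : Extends B N m m')
    (hm : m.CountsValid K B) (k : ℕ) : Grows N k m m' where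
  root := h.root
  n := h.n
  thr := h.thr
  srch := h.srch
  leaf := h.leaf
  cnt g hg := by
    rcases h.node g with h1 | h1
    · exact h1.1.ge
    · rw [(hm.zero g hg h1.1).1]
      exact Nat.zero_le _
  old g hg _ := (h.node g).resolve_right fun h1 => h1.1 hg
  cntA g hg _ a := by
    rcases h.node g with h1 | ⟨h1, -, -, b, v, -, h2, h3, -⟩
    · rw [h1.2.1]
    · by_cases hab : a = b
      · rw [hab, h3]
        exact Nat.zero_le _
      · rw [(h2 a hab).1]

/-- An inserted node had no visits before and now has exactly one; the summand `1` of `visitBound`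
keeps it balanced. -/
theorem Extends.countsValid {K B : ℝ} {N : ℕ} {m m' : Memory A Z} (h : Extends B N m m')
    (hm : m.CountsValid K B) : m'.CountsValid K B where
  root_mem := h.srch (h.root ▸ hm.root_mem)
  zero g hg hgs := by
    rcases h.node g with h1 | h1
    · rw [h1.1, h1.2.1]
      exact hm.zero g (h.root ▸ hg) fun h2 => hgs (h.srch h2)
    · exact absurd h1.2.1 hgs
  sum g hg := by
    classical
    rcases h.node g with h1 | ⟨h1, -, h4, b, v, -, h2, h3, -⟩
    · rw [h1.1, h1.2.1]
      exact hm.sum g (h.root ▸ hg)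
    · rw [h4, Finset.sum_eq_single b, h3]
      · intro c _ hc
        rw [(h2 c hc).1, (hm.zero g (h.root ▸ hg) h1).2]
      · simp
  balance g hg a b := by
    rcases h.node g with h1 | ⟨h1, -, h4, c, v, -, h2, h3, -⟩
    · rw [h1.2.1]
      exact hm.balance g (h.root ▸ hg) a b
    · have hle : ∀ d, m'.cntA g d ≤ 1 := fun d => by
        by_cases hd : d = c
        · rw [hd, h3]
        · rw [(h2 d hd).1, (hm.zero g (h.root ▸ hg) h1).2]
          exact Nat.zero_le _
      have h5 : (m'.cntA g b : ℝ) ≤ 1 := by exact_mod_cast hle b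
      have h6 : (0 : ℝ) ≤ m'.cntA g a := Nat.cast_nonneg _
      unfold visitBound
      have := Real.exp_pos (16 * B ^ 2 * (m'.cntA g a : ℝ) / K ^ 2)
      linarith
  val g a := by
    rcases h.node g with h1 | ⟨-, -, -, b, v, h1, h2, -, h3⟩
    · rw [h1.2.2]
      exact hm.val g a
    · by_cases hab : a = b
      · rw [hab, h3]
        exact h1
      · rw [(h2 a hab).2]
        exact hm.val g a

end Counts

end Memory

/-! ### Effect of `UpdateTrees` and of recording a visit -/

namespace POMDP

variable {S A Z : Type*} [Fintype S] [Fintype A] [Fintype Z] [Nonempty A]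

/-- A bound for the absolute values of the rewards. -/
def rewardBound (P : POMDP S A Z) : ℝ := ∑ s, ∑ a, |P.reward s a|

theorem abs_rew_le (P : POMDP S A Z) (h : Hist A Z) (a : A) : |P.rew h a| ≤ P.rewardBound :=
  (Finset.single_le_sum (f := fun a => |P.reward (P.belief h).support_nonempty.some a|)
    (fun _ _ => abs_nonneg _) (Finset.mem_univ a)).trans
    (Finset.single_le_sum (f := fun s => ∑ a, |P.reward s a|)
      (fun _ _ => Finset.sum_nonneg fun _ _ => abs_nonneg _) (Finset.mem_univ _))

theorem rewardBound_nonneg (P : POMDP S A Z) : 0 ≤ P.rewardBound :=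
  Finset.sum_nonneg fun _ _ => Finset.sum_nonneg fun _ _ => abs_nonneg _

open Classical in
-- Each level adds at most one reward to `R`. The quantity `|R| + g.length * rewardBound` therefore
-- does not grow on the way up and bounds every value that is stored.
theorem backup_extends (P : POMDP S A Z) (B : ℝ) (N : ℕ) (g : Hist A Z) : ∀ (R : ℝ)
    (m : Memory A Z), g.length ≤ N → |R| + g.length * P.rewardBound ≤ B →
    m.Extends B N (P.backup g R m) := by
  induction g with
  | nil => exact fun _ m _ _ => Memory.Extends.refl B N m
  | cons y g ih =>
    obtain ⟨a, o⟩ := y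
    intro R m hN hR
    rw [List.length_cons] at hN
    rw [List.length_cons, Nat.cast_succ, add_mul, one_mul] at hR
    have hrb := P.rewardBound_nonneg
    have hU : ∀ (u : ℝ) (x : Hist A Z), x.length = N → m.U x = 0 →
        Function.update m.U g u x = 0 := by
      intro u x hx h0
      rw [Function.update_of_ne, h0]
      rintro rfl
      omega
    rw [backup]
    split_ifs with hr hs
    · exact Memory.Extends.refl B N m
    · refine Memory.Extends.trans ?_ (ih _ _ (by omega) (by linarith))
      exact ⟨rfl, rfl, rfl, subset_rfl, hU _, fun _ => Or.inl ⟨rfl, rfl, rfl⟩⟩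
    · have h1 : |R + P.rew g a| ≤ |R| + P.rewardBound :=
        (abs_add_le _ _).trans (by linarith [P.abs_rew_le g a])
      refine Memory.Extends.trans ?_ (ih _ _ (by omega) (by linarith))
      refine ⟨rfl, rfl, rfl, Set.subset_insert _ _, hU _, fun x => ?_⟩
      by_cases hx : x = (a, o) :: g
      · subst hx
        refine Or.inr ⟨hs, Set.mem_insert _ _, by simp, a, R + P.rew g a, ?_, ?_, ?_, ?_⟩
        · have : 0 ≤ (g.length : ℝ) * P.rewardBound := by positivity
          linarith
        · intro b hb
          simp [Function.update_of_ne hb]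
        · simp
        · simp
      · exact Or.inl ⟨by simp [hx], by simp [hx], by simp [hx]⟩

theorem nodeBound_congr (P : POMDP S A Z) {U U' : Hist A Z → ℝ} {h : Hist A Z}
    (hU : ∀ a o, U ((a, o) :: h) = U' ((a, o) :: h)) : P.nodeBound U h = P.nodeBound U' h := by
  unfold nodeBound
  congr 1
  funext a
  simp only [actionBound, hU]

open Classical in
theorem backup_U_of_length_le (P : POMDP S A Z) (g : Hist A Z) : ∀ (R : ℝ) (m : Memory A Z)
    (x : Hist A Z), g.length ≤ x.length → (P.backup g R m).U x = m.U x := by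
  induction g with
  | nil => exact fun _ _ _ _ => rfl
  | cons y g ih =>
    obtain ⟨a, o⟩ := y
    intro R m x hx
    rw [List.length_cons] at hx
    have hne : x ≠ g := by
      rintro rfl
      omega
    rw [backup]
    split_ifs with hr hs
    · rfl
    all_goals
      rw [ih _ _ _ (by omega)]
      simp [Function.update_of_ne hne]

open Classical in
-- The recursion for `U` is allowed to fail at the parent of the current node only. One step of the
-- loop repairs it there and can break it only at the next parent.
theorem backup_U_eq_nodeBound (P : POMDP S A Z) (N : ℕ) (g : Hist A Z) : ∀ (R : ℝ)
    (m : Memory A Z),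
    (∀ x, m.root <:+ x → x.length < N → (∀ y, y :: x ≠ g) → m.U x = P.nodeBound m.U x) →
    ∀ x, m.root <:+ x → x.length < N →
      (P.backup g R m).U x = P.nodeBound (P.backup g R m).U x := by
  induction g with
  | nil => exact fun _ _ h x hx hN => h x hx hN fun y => by simp
  | cons y g ih =>
    obtain ⟨a, o⟩ := y
    intro R m h x hx hN
    have key : ∀ x, m.root <:+ x → x.length < N → (∀ y, y :: x ≠ g) →
        Function.update m.U g
          (P.nodeBound m.U g) x =
        P.nodeBound (Function.update m.U g
          (P.nodeBound m.U g)) x := by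
      intro x hx hN hy
      have hc : P.nodeBound (Function.update m.U g
          (P.nodeBound m.U g)) x = P.nodeBound m.U x :=
        P.nodeBound_congr fun a o => Function.update_of_ne (hy _) _ _
      rw [hc]
      by_cases hxg : x = g
      · subst hxg
        simp
      · rw [Function.update_of_ne hxg]
        exact h x hx hN fun y hyx => hxg (List.cons.inj hyx).2
    rw [backup]
    split_ifs with hr hs
    -- When the loop stops at the root, the exceptional node lies strictly above the root, so no
    -- exception remains.
    · refine h x hx hN fun y hy => ?_
      have := hx.length_le
      rw [← hr, ← hy, List.length_cons] at this
      omega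
    · exact ih _ _ key x hx hN
    · exact ih _ _ key x hx hN

/-- The invariants of the risk bounds. -/
structure BoundsValid (P : POMDP S A Z) (γ τ : ℝ) (N : ℕ) (m : Memory A Z) : Prop where
  node : ∀ g, m.root <:+ g → g.length < N → m.U g = P.nodeBound m.U g
  leaf : ∀ g, g.length = N → m.U g = 1 ∨ (m.U g = 0 ∧ P.residual γ τ g ≤ 0)

/-- The invariants of the memory of the algorithm. -/
structure Valid (P : POMDP S A Z) (γ τ K : ℝ) (N : ℕ) (m : Memory A Z) : Prop where
  counts : m.CountsValid K (N * P.rewardBound)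
  bounds : P.BoundsValid γ τ N m
  length : m.root.length + m.n = N
  isHistory : P.IsHistory m.root
  thr : m.thr = P.residual γ τ m.root

variable {P : POMDP S A Z} {γ τ K : ℝ} {N : ℕ} {m m' : Memory A Z} {h : Hist A Z}

open Classical in
theorem updateTrees_extends (P : POMDP S A Z) (hh : h.length = N) (m : Memory A Z) :
    m.Extends (N * P.rewardBound) N (P.updateTrees h m) := by
  rw [updateTrees]
  refine Memory.Extends.trans ?_ (P.backup_extends _ N h 0 _ hh.le (by simp [hh]))
  refine ⟨rfl, rfl, rfl, subset_rfl, fun g _ h0 => ?_, fun _ => Or.inl ⟨rfl, rfl, rfl⟩⟩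
  by_cases hg : g = h
  · simp [hg]
  · simp [Function.update_of_ne hg, h0]

open Classical in
theorem updateTrees_U_self (P : POMDP S A Z) (h : Hist A Z) (m : Memory A Z) :
    (P.updateTrees h m).U h = 0 := by
  rw [updateTrees, backup_U_of_length_le _ _ _ _ _ le_rfl]
  simp

open Classical in
theorem BoundsValid.updateTrees (hm : P.BoundsValid γ τ N m) (hh : h.length = N)
    (hres : P.residual γ τ h ≤ 0) : P.BoundsValid γ τ N (P.updateTrees h m) where
  node g hg hN := by
    rw [POMDP.updateTrees]
    rw [(P.updateTrees_extends hh m).root] at hg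
    refine P.backup_U_eq_nodeBound N h _ _ (fun x hx hxN hy => ?_) g hg hN
    have hxh : x ≠ h := by
      rintro rfl
      omega
    simp only [Function.update_of_ne hxh]
    rw [hm.node x hx hxN]
    exact P.nodeBound_congr fun a o => by rw [Function.update_of_ne (hy _)]
  leaf g hg := by
    by_cases hgh : g = h
    · rw [hgh]
      exact Or.inr ⟨P.updateTrees_U_self h m, hres⟩
    · rw [POMDP.updateTrees, backup_U_of_length_le _ _ _ _ _ (by omega)]
      simp only [Function.update_of_ne hgh]
      exact hm.leaf g hg

theorem beliefFinish_extends (hh : h.length = N) :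
    m.Extends (N * P.rewardBound) N (P.beliefFinish γ τ h m) := by
  rw [beliefFinish]
  split_ifs with hres
  · exact P.updateTrees_extends hh m
  · exact Memory.Extends.refl _ _ _

theorem Valid.beliefFinish (hm : P.Valid γ τ K N m) (hh : h.length = N) :
    P.Valid γ τ K N (P.beliefFinish γ τ h m) where
  counts := (beliefFinish_extends hh).countsValid hm.counts
  bounds := by
    rw [POMDP.beliefFinish]
    split_ifs with hres
    · exact hm.bounds.updateTrees hh hres
    · exact hm.bounds
  length := by
    rw [(beliefFinish_extends hh).root, (beliefFinish_extends hh).n]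
    exact hm.length
  isHistory := by
    rw [(beliefFinish_extends hh).root]
    exact hm.isHistory
  thr := by
    rw [(beliefFinish_extends hh).root, (beliefFinish_extends hh).thr]
    exact hm.thr

theorem Valid.insert_srch (hm : P.Valid γ τ K N m) (h : Hist A Z) :
    P.Valid γ τ K N { m with srch := insert h m.srch } where
  counts :=
    { hm.counts with
      root_mem := Set.mem_insert_of_mem _ hm.counts.root_mem
      zero := fun g hg hgs => hm.counts.zero g hg fun hg' => hgs (Set.mem_insert_of_mem _ hg') }
  bounds := ⟨hm.bounds.node, hm.bounds.leaf⟩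
  length := hm.length
  isHistory := hm.isHistory
  thr := hm.thr

theorem grows_insert_srch (N k : ℕ) (m : Memory A Z) (h : Hist A Z) :
    m.Grows N k { m with srch := insert h m.srch } :=
  ⟨rfl, rfl, rfl, Set.subset_insert _ _, fun _ _ h => h, fun _ _ => le_rfl,
    fun _ _ _ => ⟨rfl, rfl, rfl⟩, fun _ _ _ _ => le_rfl⟩

/-- If `a` is chosen although `N_a > 4 N_b`, its exploration bonus is at most half that of `b`. The
values differ by at most `2 B`, so the bonus of `b` is at most `4 B`; this bounds `log h.N`, and
with it `N_a`, in terms of `N_b`. -/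
theorem succ_cntA_le_visitBound {B : ℝ} (hK : 0 < K) (hm : m.CountsValid K B)
    (hh : m.root <:+ h) {a : A} (ha : a ∈ bestActions K m h) (b : A) :
    (m.cntA h a : ℝ) + 1 ≤ visitBound K B (m.cntA h b) := by
  have hB : 0 ≤ B := (abs_nonneg _).trans (hm.val h a)
  have hscore : score K m h b ≤ score K m h a := (Finset.mem_filter.1 ha).2 b
  have hexp := Real.exp_pos (16 * B ^ 2 * (m.cntA h b : ℝ) / K ^ 2)
  have hb0 : (0 : ℝ) ≤ m.cntA h b := Nat.cast_nonneg _
  unfold visitBound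
  by_cases hb : m.cntA h b = 0
  -- An untried `b` has score `⊤`, so a maximizing `a` is untried as well.
  · have ha0 : m.cntA h a = 0 := by
      by_contra h0
      rw [score, score, if_pos hb, if_neg h0] at hscore
      exact absurd hscore (EReal.coe_lt_top _).not_ge
    rw [ha0, hb] at *
    simp
  by_cases hle : (m.cntA h a : ℝ) ≤ 4 * m.cntA h b
  · linarith
  push Not at hle
  have hc : (1 : ℝ) ≤ m.cntA h b := by exact_mod_cast Nat.one_le_iff_ne_zero.2 hb
  have ha0 : m.cntA h a ≠ 0 := by
    intro h0
    rw [h0] at hle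
    norm_num at hle
    linarith
  rw [score, score, if_neg hb, if_neg ha0, EReal.coe_le_coe_iff] at hscore
  have hcnt : m.cntA h a ≤ m.cnt h := by
    rw [hm.sum h hh]
    exact Finset.single_le_sum (f := m.cntA h) (fun _ _ => Nat.zero_le _) (Finset.mem_univ a)
  have hcnt1 : (1 : ℝ) ≤ m.cnt h := by
    exact_mod_cast (Nat.one_le_iff_ne_zero.2 ha0).trans hcnt
  have hL : 0 ≤ Real.log (m.cnt h) := Real.log_nonneg hcnt1
  set L := Real.log (m.cnt h) with hLdef
  have hsq : Real.sqrt (L / m.cntA h a) ≤ Real.sqrt (L / m.cntA h b) / 2 := by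
    rw [show Real.sqrt (L / m.cntA h b) / 2 = Real.sqrt (L / (4 * m.cntA h b)) by
      rw [show L / (4 * (m.cntA h b : ℝ)) = L / m.cntA h b / 2 ^ 2 by field_simp; norm_num,
        Real.sqrt_div' (L / _) (by positivity), Real.sqrt_sq (by norm_num)]]
    apply Real.sqrt_le_sqrt
    gcongr
  have hva := abs_le.1 (hm.val h a)
  have hvb := abs_le.1 (hm.val h b)
  -- Comparing scores, half the bonus of `b` is at most `V_a - V_b ≤ 2 B`.
  have h1 : K * Real.sqrt (L / m.cntA h b) ≤ 4 * B := by nlinarith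
  have h2 : L / m.cntA h b ≤ (4 * B / K) ^ 2 := by
    rw [← Real.sqrt_le_left (by positivity), le_div_iff₀ hK]
    linarith
  have h3 : L ≤ 16 * B ^ 2 * m.cntA h b / K ^ 2 := by
    rw [div_le_iff₀ (by linarith)] at h2
    refine h2.trans_eq ?_
    field_simp
    ring
  have h4 : (m.cnt h : ℝ) ≤ Real.exp (16 * B ^ 2 * m.cntA h b / K ^ 2) :=
    (Real.log_le_iff_le_exp (by linarith)).1 h3
  have h5 : (m.cntA h a : ℝ) ≤ m.cnt h := by exact_mod_cast hcnt
  linarith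

open Classical in
theorem _root_.Memory.CountsValid.recordVisit {B : ℝ} (hK : 0 < K) (hm : m.CountsValid K B)
    (hh : m.root <:+ h) (hs : h ∈ m.srch) {a : A} (ha : a ∈ bestActions K m h) {R : ℝ}
    (hR : |R| ≤ B) : (recordVisit h a R m).CountsValid K B where
  root_mem := hm.root_mem
  zero g hg hgs := by
    have hne : g ≠ h := by
      rintro rfl
      exact hgs hs
    simp only [POMDP.recordVisit, Function.update_of_ne hne]
    exact hm.zero g hg hgs
  sum g hg := by
    by_cases hgh : g = h
    · subst hgh
      simp only [POMDP.recordVisit, Function.update_self]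
      rw [hm.sum g hg, ← Finset.add_sum_erase _ _ (Finset.mem_univ a),
        ← Finset.add_sum_erase (a := a) _ (Function.update _ _ _) (Finset.mem_univ a),
        Function.update_self, add_right_comm]
      congr 1
      exact Finset.sum_congr rfl fun b hb => by rw [Function.update_of_ne (Finset.ne_of_mem_erase hb)]
    · simp only [POMDP.recordVisit, Function.update_of_ne hgh]
      exact hm.sum g hg
  balance g hg b c := by
    by_cases hgh : g = h
    · subst hgh
      simp only [POMDP.recordVisit, Function.update_self, Function.update_apply]
      have h0 : (m.cntA g b : ℝ) ≤ m.cntA g b + 1 := by linarith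
      split_ifs with h1 h2 h2
      · subst h1 h2
        push_cast
        exact (succ_cntA_le_visitBound hK hm hg ha _).trans (visitBound_mono K B h0)
      · push_cast
        exact succ_cntA_le_visitBound hK hm hg ha b
      · subst h2
        push_cast
        exact (hm.balance g hg b c).trans (visitBound_mono K B h0)
      · exact hm.balance g hg b c
    · simp only [POMDP.recordVisit, Function.update_of_ne hgh]
      exact hm.balance g hg b c
  val g b := by
    by_cases hgh : g = h
    · subst hgh
      simp only [POMDP.recordVisit, Function.update_self, Function.update_apply]
      split_ifs with h1
      · subst h1
        have hv := abs_le.1 (hm.val g b)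
        have hr := abs_le.1 hR
        push_cast
        have hn : (0 : ℝ) < m.cntA g b + 1 := by positivity
        -- The update is a running mean, hence a convex combination of the old value and `R`, and
        -- stays in `[-B, B]`.
        have e : m.val g b + (R - m.val g b) / ((m.cntA g b : ℝ) + 1) =
            (m.cntA g b * m.val g b + R) / (m.cntA g b + 1) := by
          field_simp
          ring
        have hn0 : (0 : ℝ) ≤ m.cntA g b := Nat.cast_nonneg _
        rw [e, abs_le, le_div_iff₀ hn, div_le_iff₀ hn]
        constructor <;> nlinarith
      · exact hm.val g b
    · simp only [POMDP.recordVisit, Function.update_of_ne hgh]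
      exact hm.val g b

theorem Valid.recordVisit (hK : 0 < K) (hm : P.Valid γ τ K N m) (hh : m.root <:+ h)
    (hs : h ∈ m.srch) {a : A} (ha : a ∈ bestActions K m h) {R : ℝ}
    (hR : |R| ≤ N * P.rewardBound) : P.Valid γ τ K N (recordVisit h a R m) where
  counts := hm.counts.recordVisit hK hh hs ha hR
  bounds := ⟨hm.bounds.node, hm.bounds.leaf⟩
  length := hm.length
  isHistory := hm.isHistory
  thr := hm.thr

open Classical in
theorem grows_recordVisit (N : ℕ) (m : Memory A Z) (h : Hist A Z) (a : A) (R : ℝ) :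
    m.Grows N h.length (recordVisit h a R m) := by
  have hne : ∀ g : Hist A Z, g.length < h.length → g ≠ h := by
    rintro g hg rfl
    omega
  refine ⟨rfl, rfl, rfl, subset_rfl, fun _ _ h => h, fun g _ => ?_, fun g _ hk => ?_,
    fun g _ hk b => ?_⟩
  · simp only [recordVisit, Function.update_apply]
    split_ifs with h1
    · rw [h1]
      omega
    · exact le_rfl
  · simp [recordVisit, Function.update_of_ne (hne g hk)]
  · simp [recordVisit, Function.update_of_ne (hne g hk)]

end POMDP

/-! ### Invariants of a simulation -/

namespace POMDP

variable {S A Z : Type*} [Fintype S] [Fintype A] [Fintype Z] [Nonempty A]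
variable {P : POMDP S A Z} {γ τ K : ℝ} {N : ℕ} {m m' : Memory A Z} {h : Hist A Z}

theorem abs_return_le (hγ0 : 0 < γ) (hγ1 : γ < 1) {d : ℕ} {R : ℝ} (hR : |R| ≤ d * P.rewardBound)
    (h : Hist A Z) (a : A) : |P.rew h a + γ * R| ≤ (d + 1 : ℕ) * P.rewardBound := by
  have h1 : |γ * R| ≤ |R| := by
    rw [abs_mul, abs_of_pos hγ0]
    exact mul_le_of_le_one_left (abs_nonneg _) hγ1.le
  push_cast
  linarith [abs_add_le (P.rew h a) (γ * R), P.abs_rew_le h a]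

theorem beliefRollout_support (hγ0 : 0 < γ) (hγ1 : γ < 1) (hm : P.Valid γ τ K N m) (d : ℕ) :
    ∀ h : Hist A Z, h.length + d = N → ∀ x ∈ (P.beliefRollout γ τ d h m).support,
      P.Valid γ τ K N x.1 ∧ m.Extends (N * P.rewardBound) N x.1 ∧ |x.2| ≤ d * P.rewardBound := by
  induction d with
  | zero =>
    intro h hh x hx
    rw [beliefRollout, PMF.mem_support_pure_iff] at hx
    subst hx
    exact ⟨hm.beliefFinish hh, beliefFinish_extends hh, by simp⟩
  | succ d ih =>
    intro h hh x hx
    simp only [beliefRollout, PMF.mem_support_bind_iff, PMF.mem_support_map_iff] at hx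
    obtain ⟨a, -, o, -, y, hy, rfl⟩ := hx
    obtain ⟨h1, h2, h3⟩ := ih _ (by rw [List.length_cons]; omega) y hy
    exact ⟨h1, h2, abs_return_le hγ0 hγ1 h3 h a⟩

theorem suffix_cons_of_suffix {α : Type*} {l₁ l₂ : List α} (hl : l₁ <:+ l₂) (x : α) :
    l₁ <:+ x :: l₂ := hl.trans (List.suffix_cons x l₂)

variable {tie : Finset A → PMF A}

theorem bestActions_nonempty (K : ℝ) (m : Memory A Z) (h : Hist A Z) :
    (bestActions K m h).Nonempty := by
  obtain ⟨a, -, ha⟩ := Finset.exists_max_image Finset.univ (score K m h) Finset.univ_nonempty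
  exact ⟨a, Finset.mem_filter.2 ⟨Finset.mem_univ a, fun b => ha b (Finset.mem_univ b)⟩⟩

theorem bestActions_congr (h1 : m'.cnt h = m.cnt h) (h2 : m'.cntA h = m.cntA h)
    (h3 : m'.val h = m.val h) : bestActions K m' h = bestActions K m h := by
  have e : score K m' h = score K m h := by
    funext a
    simp only [score, h1, h2, h3]
  simp only [bestActions, e]

theorem beliefSimulate_support (hγ0 : 0 < γ) (hγ1 : γ < 1) (hK : 0 < K)
    (htie : ∀ F : Finset A, F.Nonempty → (tie F).support ⊆ (F : Set A))
    (hm : P.Valid γ τ K N m) (d : ℕ) :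
    ∀ h : Hist A Z, m.root <:+ h → h.length + d = N →
      ∀ x ∈ (P.beliefSimulate γ τ K tie d h m).support,
        P.Valid γ τ K N x.1 ∧ m.Grows N h.length x.1 ∧ |x.2| ≤ d * P.rewardBound := by
  induction d with
  | zero =>
    intro h _ hh x hx
    rw [beliefSimulate, PMF.mem_support_pure_iff] at hx
    subst hx
    exact ⟨hm.beliefFinish hh, (beliefFinish_extends hh).grows hm.counts _, by simp⟩
  | succ d ih =>
    intro h hr hh x hx
    rw [beliefSimulate] at hx
    split_ifs at hx with hs
    swap
    · obtain ⟨h1, h2, h3⟩ :=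
        beliefRollout_support hγ0 hγ1 (hm.insert_srch h) (d + 1) h hh x hx
      exact ⟨h1, (grows_insert_srch N _ m h).trans (h2.grows (hm.insert_srch h).counts _), h3⟩
    simp only [PMF.mem_support_bind_iff, PMF.mem_support_map_iff] at hx
    obtain ⟨a, ha, o, -, y, hy, rfl⟩ := hx
    have hlen : ((a, o) :: h).length + d = N := by
      rw [List.length_cons]
      omega
    obtain ⟨h1, h2, h3⟩ := ih _ (suffix_cons_of_suffix hr _) hlen y hy
    have hR := abs_return_le hγ0 hγ1 h3 h a
    -- The recursive call works below `h` and leaves its statistics alone, so `a` is still maximal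
    -- when the visit is recorded.
    have hold := h2.old h hs (by simp)
    refine ⟨h1.recordVisit hK (h2.root ▸ hr) (h2.srch hs) ?_ ?_,
      (h2.mono (by simp)).trans (grows_recordVisit N _ h a _), hR⟩
    · rw [bestActions_congr hold.1 hold.2.1 hold.2.2]
      exact htie _ (bestActions_nonempty K m h) ha
    · refine hR.trans (mul_le_mul_of_nonneg_right ?_ P.rewardBound_nonneg)
      exact_mod_cast (by omega : d + 1 ≤ N)

open Classical in
/-- The number of times that a node was reached, up to a bounded error. -/
def arrivals (m : Memory A Z) (h : Hist A Z) : ℕ := m.cnt h + if h ∈ m.srch then 1 else 0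

theorem arrivals_le (hg : m.Grows N 0 m') (hh : m.root <:+ h) : arrivals m h ≤ arrivals m' h := by
  have h1 := hg.cnt h hh
  have h2 : h ∈ m.srch → h ∈ m'.srch := fun hs => hg.srch hs
  unfold arrivals
  split_ifs <;> (simp_all; try omega)

/-- The first arrival only inserts the node in the search tree without raising `h.N`; the extra
summand in `arrivals` counts it. -/
theorem arrivals_lt (hγ0 : 0 < γ) (hγ1 : γ < 1) (hK : 0 < K)
    (htie : ∀ F : Finset A, F.Nonempty → (tie F).support ⊆ (F : Set A))
    (hm : P.Valid γ τ K N m) {d : ℕ} (hr : m.root <:+ h) (hh : h.length + (d + 1) = N)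
    {x : Memory A Z × ℝ} (hx : x ∈ (P.beliefSimulate γ τ K tie (d + 1) h m).support) :
    arrivals m h < arrivals x.1 h ∧ (h ∈ m.srch → x.1.cnt h = m.cnt h + 1) := by
  rw [beliefSimulate] at hx
  split_ifs at hx with hs
  swap
  · obtain ⟨-, h2, -⟩ := beliefRollout_support hγ0 hγ1 (hm.insert_srch h) (d + 1) h hh x hx
    refine ⟨?_, fun h => absurd h hs⟩
    have h3 := (h2.grows (hm.insert_srch h).counts h.length)
    have h4 : h ∈ x.1.srch := h3.srch (Set.mem_insert h _)
    have h5 := h3.cnt h hr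
    simp only at h5
    rw [arrivals, arrivals, if_neg hs, if_pos h4]
    omega
  simp only [PMF.mem_support_bind_iff, PMF.mem_support_map_iff] at hx
  obtain ⟨a, ha, o, -, y, hy, rfl⟩ := hx
  obtain ⟨-, h2, -⟩ := beliefSimulate_support hγ0 hγ1 hK htie hm d _
    (suffix_cons_of_suffix hr (a, o)) (by rw [List.length_cons]; omega) y hy
  have h3 := (h2.old h hs (by simp)).1
  have h4 : h ∈ y.1.srch := h2.srch hs
  have h5 : (recordVisit h a (P.rew h a + γ * y.2) y.1).cnt h = m.cnt h + 1 := by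
    simp [recordVisit, h3]
  refine ⟨?_, fun _ => h5⟩
  rw [arrivals, arrivals, if_pos hs, if_pos (by exact h4), h5]
  omega

/-! ### Failure measures and the decreasing potential -/

/-- What is required of a measure of the failure to explore the node `c`: simulations never
increase it, and those that pass through `c` halve it. -/
structure IsFailure (P : POMDP S A Z) (γ τ K : ℝ) (N : ℕ) (tie : Finset A → PMF A)
    (c : Hist A Z) (Ψ : Memory A Z → ℝ≥0∞) : Prop where
  ne_top : ∀ m, Ψ m ≠ ⊤
  grows : ∀ {m m' : Memory A Z}, m.root <:+ c → m.Grows N 0 m' → Ψ m' ≤ Ψ m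
  visit : ∀ {m : Memory A Z} {d : ℕ}, P.Valid γ τ K N m → m.root <:+ c → c.length + d = N →
    ∀ x ∈ (P.beliefSimulate γ τ K tie d c m).support, Ψ x.1 ≤ 2⁻¹ * Ψ m
  play : ∀ (m : Memory A Z) a d o R, (a, o) :: m.root <:+ c → Ψ (afterPlay γ a d o R m) ≤ Ψ m

/-- Used for inner nodes: a simulation ending at a leaf does not itself count as an arrival, hence
`c.length < N`. -/
theorem isFailure_arrivals (hγ0 : 0 < γ) (hγ1 : γ < 1) (hK : 0 < K)
    (htie : ∀ F : Finset A, F.Nonempty → (tie F).support ⊆ (F : Set A)) {c : Hist A Z}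
    (hc : c.length < N) :
    P.IsFailure γ τ K N tie c fun m => (2⁻¹ : ℝ≥0∞) ^ arrivals m c where
  ne_top m := ENNReal.pow_ne_top (by simp)
  grows hr hg := pow_le_pow_right_of_le_one' (by simp) (arrivals_le hg hr)
  visit {m d} hm hr hd x hx := by
    obtain ⟨e, rfl⟩ : ∃ e, d = e + 1 := ⟨d - 1, by omega⟩
    rw [← pow_succ']
    exact pow_le_pow_right_of_le_one' (by simp) (arrivals_lt hγ0 hγ1 hK htie hm hr hd hx).1
  play m a d o R hc := by
    refine pow_le_pow_right_of_le_one' (by simp) ?_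
    have : c ∈ m.srch → c ∈ (afterPlay γ a d o R m).srch := fun hs =>
      Set.mem_insert_of_mem _ ⟨hs, hc⟩
    unfold arrivals
    have e : (afterPlay γ a d o R m).cnt = m.cnt := rfl
    rw [e]
    split_ifs <;> simp_all

open Classical in
-- Reaching a successful leaf sets its `U` to `0` for good, so a single visit brings the failure
-- from `1` to `0`.
theorem isFailure_leaf {c : Hist A Z} (hc : c.length = N) (hres : P.residual γ τ c ≤ 0) :
    P.IsFailure γ τ K N tie c fun m => if m.U c = 0 then 0 else 1 where
  ne_top m := by split_ifs <;> simp
  grows {m m'} _ hg := by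
    by_cases h0 : m.U c = 0
    · rw [if_pos h0, if_pos (hg.leaf c hc h0)]
    · rw [if_neg h0]
      split_ifs <;> simp
  visit {m d} hm hr hd x hx := by
    obtain rfl : d = 0 := by omega
    rw [beliefSimulate, PMF.mem_support_pure_iff] at hx
    subst hx
    rw [beliefFinish, if_pos hres, if_pos (P.updateTrees_U_self c m)]
    exact zero_le
  play m a d o R hc := le_rfl

open Classical in
/-- The factor by which a visit of the child `o` is expected to decrease a failure measure. -/
def decay (p : PMF Z) (o₀ : Z) : ℝ≥0∞ :=
  p.expect fun o => if o = o₀ then 2⁻¹ else 1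

theorem decay_ne_zero (p : PMF Z) (o₀ : Z) : decay p o₀ ≠ 0 := by
  have : (2⁻¹ : ℝ≥0∞) ≤ decay p o₀ := by
    rw [← p.expect_const 2⁻¹]
    refine p.expect_mono fun o _ => ?_
    split_ifs <;> simp
  exact fun h => by simp [h] at this

theorem decay_lt_one {p : PMF Z} {o₀ : Z} (ho : o₀ ∈ p.support) : decay p o₀ < 1 := by
  classical
  have hle : decay p o₀ ≤ 1 := p.expect_le fun o _ => by split_ifs <;> simp
  rw [← p.tsum_coe]
  refine ENNReal.tsum_lt_tsum (i := o₀) (f := fun o => p o * if o = o₀ then 2⁻¹ else 1) ?_ (fun o => ?_) ?_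
  · exact ne_top_of_le_ne_top ENNReal.one_ne_top hle
  · refine mul_le_of_le_one_right' ?_
    split_ifs <;> simp
  · rw [if_pos rfl, ← div_eq_mul_inv]
    exact ENNReal.half_lt_self ho (p.apply_ne_top o₀)

open Classical in
/-- The potential that decreases on average: failures to explore the child `ao` of `g`, weighted
with the number of times that `a` was tried in `g`. -/
def potential (P : POMDP S A Z) (g : Hist A Z) (a : A) (o : Z) (Ψ : Memory A Z → ℝ≥0∞)
    (m : Memory A Z) : ℝ≥0∞ :=
  if m.root <:+ g then (decay (P.obsPMF g a) o)⁻¹ ^ (m.cntA g a - 1) * Ψ m else 0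

variable {g : Hist A Z} {a₀ : A} {o₀ : Z} {Ψ : Memory A Z → ℝ≥0∞}

theorem one_le_inv_decay (p : PMF Z) (o₀ : Z) : 1 ≤ (decay p o₀)⁻¹ := by
  rw [ENNReal.one_le_inv]
  exact p.expect_le fun o _ => by split_ifs <;> simp

theorem potential_mono (hΨ : P.IsFailure γ τ K N tie ((a₀, o₀) :: g) Ψ)
    (hg : m.Grows N 0 m') (hc : m'.cntA g a₀ - 1 ≤ m.cntA g a₀ - 1) :
    P.potential g a₀ o₀ Ψ m' ≤ P.potential g a₀ o₀ Ψ m := by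
  unfold potential
  rw [hg.root]
  split_ifs with hr
  · gcongr
    · exact one_le_inv_decay _ _
    · exact hΨ.grows (suffix_cons_of_suffix hr _) hg
  · exact le_rfl

/-- The weight can grow only where `a₀` is tried at `g`, by a factor of at most `κ⁻¹`. The same
trial leads to the child `o₀` with its usual probability and halves `Ψ` there, so averaging over the
observation gives the compensating factor `κ`. The bound holds for each selected action, whatever
the tie-breaking rule. -/
theorem expect_beliefSimulate_potential_le (hγ0 : 0 < γ) (hγ1 : γ < 1) (hK : 0 < K)
    (htie : ∀ F : Finset A, F.Nonempty → (tie F).support ⊆ (F : Set A))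
    (hΨ : P.IsFailure γ τ K N tie ((a₀, o₀) :: g) Ψ) (hm : P.Valid γ τ K N m) (d : ℕ) :
    ∀ h : Hist A Z, m.root <:+ h → h.length + d = N →
      (P.beliefSimulate γ τ K tie d h m).expect (fun x => P.potential g a₀ o₀ Ψ x.1) ≤
        P.potential g a₀ o₀ Ψ m := by
  classical
  induction d with
  | zero =>
    intro h hr hh
    rw [beliefSimulate, PMF.expect_pure]
    by_cases hrg : m.root <:+ g
    · have hG := (beliefFinish_extends (P := P) (γ := γ) (τ := τ) (m := m) hh).grows hm.counts
      refine potential_mono hΨ (hG 0) ((hG (g.length + 1)).cntA g hrg (by omega) a₀)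
    · rw [potential, if_neg]
      · exact zero_le
      · rwa [(beliefFinish_extends hh).root]
  | succ d ih =>
    intro h hr hh
    by_cases hrg : m.root <:+ g
    swap
    · refine PMF.expect_le _ fun x hx => ?_
      rw [potential, if_neg]
      · exact zero_le
      · rwa [(beliefSimulate_support hγ0 hγ1 hK htie hm (d + 1) h hr hh x hx).2.1.root]
    rw [beliefSimulate]
    split_ifs with hs
    swap
    · refine PMF.expect_le _ fun x hx => ?_
      have h2 := (beliefRollout_support hγ0 hγ1 (hm.insert_srch h) (d + 1) h hh x hx).2.1
      have hG : ∀ k, m.Grows N k x.1 := fun k =>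
        (grows_insert_srch N k m h).trans (h2.grows (hm.insert_srch h).counts k)
      exact potential_mono hΨ (hG 0) ((hG (g.length + 1)).cntA g hrg (by omega) a₀)
    rw [PMF.expect_bind]
    refine PMF.expect_le _ fun a _ => ?_
    rw [PMF.expect_bind]
    simp only [PMF.expect_map]
    have hr' := fun o => suffix_cons_of_suffix hr (a, o)
    have hlen : ∀ o, ((a, o) :: h).length + d = N := fun o => by
      rw [List.length_cons]
      omega
    by_cases hha : h = g ∧ a = a₀
    · obtain ⟨rfl, rfl⟩ := hha
      set κ := decay (P.obsPMF h a) o₀ with hκ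
      have hκ0 : κ ≠ 0 := decay_ne_zero _ _
      have hκt : κ ≠ ⊤ := fun e => by
        have h1 := one_le_inv_decay (P.obsPMF h a) o₀
        rw [← hκ, e] at h1
        simp at h1
      -- Only an inequality holds: the first visit leaves the truncated exponent at `0`.
      have hrec : ∀ (y : Memory A Z) (R : ℝ), P.potential h a o₀ Ψ (recordVisit h a R y) ≤
          κ⁻¹ * P.potential h a o₀ Ψ y := by
        intro y R
        unfold potential
        have e1 : (recordVisit h a R y).root = y.root := rfl
        have e2 : (recordVisit h a R y).cntA h a = y.cntA h a + 1 := by simp [recordVisit]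
        rw [e1, e2]
        split_ifs with hy
        · rw [← mul_assoc, ← pow_succ', ← hκ]
          gcongr
          · exact one_le_inv_decay _ _
          · omega
          · exact hΨ.grows (suffix_cons_of_suffix hy _) ((grows_recordVisit N y h a R).mono (by omega))
        · simp
      have hstep : ∀ o, ((P.beliefSimulate γ τ K tie d ((a, o) :: h) m).expect fun x =>
          P.potential h a o₀ Ψ (recordVisit h a (P.rew h a + γ * x.2) x.1)) ≤
          (if o = o₀ then 2⁻¹ else 1) * (κ⁻¹ * P.potential h a o₀ Ψ m) := by
        intro o
        split_ifs with ho
        · subst ho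
          refine PMF.expect_le _ fun x hx => (hrec _ _).trans ?_
          have hG := (beliefSimulate_support hγ0 hγ1 hK htie hm d _ (hr' o) (hlen o) x hx).2.1
          rw [mul_left_comm]
          gcongr
          unfold potential
          rw [hG.root, if_pos hr, if_pos hr, mul_left_comm]
          exact mul_le_mul' (pow_le_pow_right' (one_le_inv_decay _ _) (hG.cntA h hr (by simp) a))
            (hΨ.visit hm (hr' o) (hlen o) x hx)
        · rw [one_mul]
          refine (PMF.expect_mono _ fun x _ => hrec _ _).trans ?_
          simp only [mul_comm κ⁻¹]
          rw [PMF.expect_mul_const]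
          gcongr
          exact ih _ (hr' o) (hlen o)
      refine (PMF.expect_mono _ fun o _ => hstep o).trans ?_
      rw [PMF.expect_mul_const, ← mul_assoc]
      change κ * κ⁻¹ * _ ≤ _
      rw [ENNReal.mul_inv_cancel hκ0 hκt, one_mul]
    · refine PMF.expect_le _ fun o _ => (PMF.expect_mono _ fun x _ => ?_).trans
        (ih _ (hr' o) (hlen o))
      refine potential_mono hΨ ((grows_recordVisit N _ h a _).mono (by omega)) (le_of_eq ?_)
      congr 1
      simp only [recordVisit]
      by_cases hgh : g = h
      · subst hgh
        have : a₀ ≠ a := fun e => hha ⟨rfl, e.symm⟩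
        simp [Function.update_of_ne this]
      · rw [Function.update_of_ne hgh]

theorem Valid.simCall_eq (hP : P.ObservableRewards) (hγ0 : 0 < γ) (hm : P.Valid γ τ K N m) :
    P.simCall γ K tie m = (P.beliefSimulate γ τ K tie m.n m.root m).map Prod.fst :=
  POMDP.simCall_eq hP hγ0 τ K tie hm.isHistory hm.thr

theorem expect_simCall_potential_le (hP : P.ObservableRewards) (hγ0 : 0 < γ) (hγ1 : γ < 1)
    (hK : 0 < K) (htie : ∀ F : Finset A, F.Nonempty → (tie F).support ⊆ (F : Set A))
    (hΨ : P.IsFailure γ τ K N tie ((a₀, o₀) :: g) Ψ) (hm : P.Valid γ τ K N m) :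
    (P.simCall γ K tie m).expect (P.potential g a₀ o₀ Ψ) ≤ P.potential g a₀ o₀ Ψ m := by
  rw [hm.simCall_eq hP hγ0, PMF.expect_map]
  exact expect_beliefSimulate_potential_le hγ0 hγ1 hK htie hΨ hm _ _ List.suffix_rfl hm.length

theorem simCall_support (hP : P.ObservableRewards) (hγ0 : 0 < γ) (hγ1 : γ < 1)
    (hK : 0 < K) (htie : ∀ F : Finset A, F.Nonempty → (tie F).support ⊆ (F : Set A))
    (hm : P.Valid γ τ K N m) (hn : 0 < m.n) (hm' : m' ∈ (P.simCall γ K tie m).support) :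
    P.Valid γ τ K N m' ∧ m'.root = m.root ∧ m'.n = m.n ∧ m'.cnt m.root = m.cnt m.root + 1 := by
  rw [hm.simCall_eq hP hγ0, PMF.mem_support_map_iff] at hm'
  obtain ⟨x, hx, rfl⟩ := hm'
  obtain ⟨h1, h2, -⟩ := beliefSimulate_support hγ0 hγ1 hK htie hm _ _ List.suffix_rfl hm.length x hx
  refine ⟨h1, h2.root, h2.n, ?_⟩
  obtain ⟨e, he⟩ : ∃ e, m.n = e + 1 := ⟨m.n - 1, by omega⟩
  rw [he] at hx
  exact (arrivals_lt hγ0 hγ1 hK htie hm List.suffix_rfl (he ▸ hm.length) hx).2 hm.counts.root_mem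

/-- Playing either keeps `g` below the root with its statistics, or discards `g`, where the
potential is `0` by convention. This holds for every outcome, so the selection rule may be
arbitrary. -/
theorem potential_afterPlay_le (hΨ : P.IsFailure γ τ K N tie ((a₀, o₀) :: g) Ψ) (m : Memory A Z)
    (a : A) (d : Z → ℝ) (o : Z) (R : ℝ) :
    P.potential g a₀ o₀ Ψ (afterPlay γ a d o R m) ≤ P.potential g a₀ o₀ Ψ m := by
  unfold potential
  have e1 : (afterPlay γ a d o R m).root = (a, o) :: m.root := rfl
  have e2 : (afterPlay γ a d o R m).cntA = m.cntA := rfl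
  rw [e1, e2]
  split_ifs with h1 h2 h2
  · gcongr
    exact hΨ.play m a d o R (suffix_cons_of_suffix h1 _)
  · exact absurd ((List.suffix_cons _ _).trans h1) h2
  · exact zero_le
  · exact le_rfl

end POMDP

/-! ### Soundness of the bounds and convergence in probability -/

namespace POMDP

variable {S A Z : Type*} [Fintype S] [Fintype A] [Fintype Z] [Nonempty A]
variable {P : POMDP S A Z} {γ τ K : ℝ} {N : ℕ} {m m' : Memory A Z} {tie : Finset A → PMF A}

theorem Valid.optRisk_le_U (hm : P.Valid γ τ K N m) (n : ℕ) : ∀ g : Hist A Z, m.root <:+ g →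
    n + g.length = N → P.optRisk γ τ n g ≤ m.U g := by
  induction n with
  | zero =>
    intro g _ hg
    rw [optRisk]
    rcases hm.bounds.leaf g (by omega) with h | ⟨h, hres⟩
    · rw [h]
      split_ifs <;> norm_num
    · rw [h, if_neg hres.not_gt]
  | succ n ih =>
    intro g hr hg
    rw [optRisk, hm.bounds.node g hr (by omega)]
    exact P.nodeBound_mono fun a o _ =>
      ih _ (suffix_cons_of_suffix hr _) (by rw [List.length_cons]; omega)

/-- Only leaves that are genuine histories matter, because impossible observations have weight zero
in the recursion. -/
theorem Valid.U_le_optRisk (hm : P.Valid γ τ K N m)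
    (hleaf : ∀ c : Hist A Z, m.root <:+ c → P.IsHistory c → c.length = N →
      P.residual γ τ c ≤ 0 → m.U c = 0) (n : ℕ) : ∀ g : Hist A Z, m.root <:+ g →
    P.IsHistory g → n + g.length = N → m.U g ≤ P.optRisk γ τ n g := by
  induction n with
  | zero =>
    intro g hr hgh hg
    rw [optRisk]
    split_ifs with hres
    · rcases hm.bounds.leaf g (by omega) with h | ⟨h, -⟩ <;> rw [h]
      exact zero_le_one
    · exact (hleaf g hr hgh (by omega) (not_lt.1 hres)).le
  | succ n ih =>
    intro g hr hgh hg
    rw [optRisk, hm.bounds.node g hr (by omega)]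
    exact P.nodeBound_mono fun a o ho =>
      ih _ (suffix_cons_of_suffix hr _) (isHistory_cons hgh ho) (by rw [List.length_cons]; omega)

theorem Valid.exists_risk_le (hP : P.ObservableRewards) (hγ : 0 < γ) (hm : P.Valid γ τ K N m) :
    ∃ σ : Policy A Z,
      P.risk γ σ (P.belief m.root) (N - m.root.length) m.thr ≤ m.U m.root := by
  have hl := hm.length
  obtain ⟨σ, hσ⟩ := exists_risk_eq_optRisk hP hγ τ (N - m.root.length) hm.isHistory
  refine ⟨σ, ?_⟩
  rw [hm.thr, hσ]
  exact hm.optRisk_le_U _ _ List.suffix_rfl (by omega)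

theorem Valid.rootOptimal (hP : P.ObservableRewards) (hγ : 0 < γ) (hm : P.Valid γ τ K N m)
    (hleaf : ∀ c : Hist A Z, m.root <:+ c → P.IsHistory c → c.length = N →
      P.residual γ τ c ≤ 0 → m.U c = 0) : P.RootOptimal γ N m := by
  have hl := hm.length
  rw [RootOptimal, hm.thr, minRisk_eq_optRisk hP hγ τ _ hm.isHistory]
  exact le_antisymm (hm.U_le_optRisk hleaf _ _ List.suffix_rfl hm.isHistory (by omega))
    (hm.optRisk_le_U _ _ List.suffix_rfl (by omega))

/-- A sequence of laws of memories in which the root is searched more and more often. -/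
structure IsSearch (P : POMDP S A Z) (γ τ K : ℝ) (N : ℕ) (tie : Finset A → PMF A)
    (ν : ℕ → PMF (Memory A Z)) : Prop where
  valid : ∀ T, ∀ m ∈ (ν T).support, P.Valid γ τ K N m ∧ 0 < m.n ∧ T ≤ m.cnt m.root
  bounded : ∀ g a o Ψ, P.IsFailure γ τ K N tie ((a, o) :: g) Ψ →
    ∃ C ≠ ⊤, ∀ T, (ν T).expect (P.potential g a o Ψ) ≤ C

variable {ν : ℕ → PMF (Memory A Z)}

theorem Valid.cnt_le (hm : P.Valid γ τ K N m) {g : Hist A Z} (hg : m.root <:+ g) (a : A) :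
    (m.cnt g : ℝ) ≤ Fintype.card A * visitBound K (N * P.rewardBound) (m.cntA g a) := by
  rw [hm.counts.sum g hg]
  push_cast
  refine (Finset.sum_le_card_nsmul _ _ _ fun b _ => hm.counts.balance g hg a b).trans_eq ?_
  rw [nsmul_eq_mul, Finset.card_univ]

/-- Many visits of `g` force many trials of `a` by the balance of counts. The weight in the
potential is then large, and its bounded expectation makes `Ψ ≥ ε` unlikely by Markov's inequality.
-/
theorem IsSearch.tendsto_failure (hν : P.IsSearch γ τ K N tie ν) {g : Hist A Z} {a : A} {o : Z}
    (ho : o ∈ (P.obsPMF g a).support) {Ψ : Memory A Z → ℝ≥0∞}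
    (hΨ : P.IsFailure γ τ K N tie ((a, o) :: g) Ψ)
    (hg : ∀ c, Tendsto (fun T => (ν T).toOuterMeasure {m | m.root <:+ g ∧ m.cnt g < c}) atTop (𝓝 0))
    {ε : ℝ≥0∞} (hε : ε ≠ 0) (hε' : ε ≠ ⊤) :
    Tendsto (fun T => (ν T).toOuterMeasure {m | m.root <:+ g ∧ ε ≤ Ψ m}) atTop (𝓝 0) := by
  obtain ⟨C, hC, hCν⟩ := hν.bounded g a o Ψ hΨ
  set κ := decay (P.obsPMF g a) o with hκ
  have hκ0 : κ ≠ 0 := decay_ne_zero _ _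
  have hκ1 : κ < 1 := decay_lt_one ho
  rw [ENNReal.tendsto_nhds_zero]
  intro δ hδ
  have hlim : Tendsto (fun k => C / ε * κ ^ k) atTop (𝓝 0) := by
    have := ENNReal.Tendsto.const_mul (a := C / ε)
      (ENNReal.tendsto_pow_atTop_nhds_zero_of_lt_one hκ1) (Or.inr (ENNReal.div_ne_top hC hε))
    simpa using this
  have hδ2 : 0 < δ / 2 := ENNReal.half_pos hδ.ne'
  -- First choose `k` trials to make the Markov bound `C κ ^ k / ε` at most `δ / 2`; then `c` visits
  -- of `g` guarantee more than `k` trials of `a`.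
  obtain ⟨k, hk⟩ := ((ENNReal.tendsto_nhds_zero.1 hlim) (δ / 2) hδ2).exists
  obtain ⟨c, hc⟩ := exists_nat_gt (Fintype.card A * visitBound K (N * P.rewardBound) k)
  filter_upwards [(ENNReal.tendsto_nhds_zero.1 (hg c)) (δ / 2) hδ2] with T hT
  have hsub : {m | m.root <:+ g ∧ ε ≤ Ψ m} ∩ (ν T).support ⊆
      {m | m.root <:+ g ∧ m.cnt g < c} ∪ {m | κ⁻¹ ^ k * ε ≤ P.potential g a o Ψ m} := by
    rintro m ⟨⟨hr, hm⟩, hmν⟩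
    by_cases hmc : m.cnt g < c
    · exact Or.inl ⟨hr, hmc⟩
    right
    have hka : k < m.cntA g a := by
      by_contra! hle
      have h1 := (hν.valid T m hmν).1.cnt_le hr a
      have h2 : visitBound K (N * P.rewardBound) (m.cntA g a) ≤
          visitBound K (N * P.rewardBound) k := visitBound_mono _ _ (by exact_mod_cast hle)
      have h3 : (Fintype.card A : ℝ) * visitBound K (N * P.rewardBound) (m.cntA g a) ≤
          Fintype.card A * visitBound K (N * P.rewardBound) k :=
        mul_le_mul_of_nonneg_left h2 (Nat.cast_nonneg _)
      exact hmc (by exact_mod_cast (h1.trans h3).trans_lt hc)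
    change _ ≤ P.potential g a o Ψ m
    rw [potential, if_pos hr]
    exact mul_le_mul' (pow_le_pow_right' (one_le_inv_decay _ _) (by omega)) hm
  have hmark := ((ν T).mul_toOuterMeasure_le_expect (P.potential g a o Ψ) (κ⁻¹ ^ k * ε)).trans
    (hCν T)
  have hle : (ν T).toOuterMeasure {m | κ⁻¹ ^ k * ε ≤ P.potential g a o Ψ m} ≤ δ / 2 := by
    refine le_trans ?_ hk
    have hκt : κ ^ k ≠ ⊤ := ENNReal.pow_ne_top hκ1.ne_top
    rw [mul_comm, ← ENNReal.le_div_iff_mul_le] at hmark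
    · refine hmark.trans_eq ?_
      rw [← ENNReal.inv_pow, div_eq_mul_inv, div_eq_mul_inv, ENNReal.mul_inv, inv_inv]
      · ring
      · exact Or.inr hε'
      · exact Or.inr hε
    · left
      exact mul_ne_zero (pow_ne_zero _ (ENNReal.inv_ne_zero.2 hκ1.ne_top)) hε
    · right
      exact hC
  calc _ ≤ (ν T).toOuterMeasure ({m | m.root <:+ g ∧ m.cnt g < c} ∪
        {m | κ⁻¹ ^ k * ε ≤ P.potential g a o Ψ m}) := (ν T).toOuterMeasure_mono hsub
    _ ≤ δ / 2 + δ / 2 := (MeasureTheory.measure_union_le _ _).trans (add_le_add hT hle)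
    _ = δ := ENNReal.add_halves δ

theorem IsSearch.tendsto_root (hν : P.IsSearch γ τ K N tie ν) (g : Hist A Z) (c : ℕ) :
    Tendsto (fun T => (ν T).toOuterMeasure {m | m.root = g ∧ m.cnt g < c}) atTop (𝓝 0) := by
  refine tendsto_const_nhds.congr' ?_
  filter_upwards [eventually_ge_atTop c] with T hT
  symm
  rw [PMF.toOuterMeasure_apply_eq_zero_iff, Set.disjoint_left]
  rintro m hm ⟨rfl, hmc⟩
  have := (hν.valid T m hm).2.2
  omega

theorem tendsto_toOuterMeasure_zero_of_subset {X : Type*} {p : ℕ → PMF X} {s t u : Set X}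
    (ht : Tendsto (fun T => (p T).toOuterMeasure t) atTop (𝓝 0))
    (hu : Tendsto (fun T => (p T).toOuterMeasure u) atTop (𝓝 0)) (h : s ⊆ t ∪ u) :
    Tendsto (fun T => (p T).toOuterMeasure s) atTop (𝓝 0) := by
  refine tendsto_of_tendsto_of_tendsto_of_le_of_le tendsto_const_nhds (by simpa using ht.add hu)
    (fun _ => zero_le) fun T => ?_
  exact (MeasureTheory.measure_mono h).trans (MeasureTheory.measure_union_le _ _)

/-- Induction along the history: a node below the root is either the root, visited in each call, or
a child of a node to which the induction hypothesis applies. -/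
theorem IsSearch.tendsto_cnt (hν : P.IsSearch γ τ K N tie ν) (hγ0 : 0 < γ) (hγ1 : γ < 1)
    (hK : 0 < K) (htie : ∀ F : Finset A, F.Nonempty → (tie F).support ⊆ (F : Set A))
    (g : Hist A Z) : P.IsHistory g → g.length < N → ∀ c,
    Tendsto (fun T => (ν T).toOuterMeasure {m | m.root <:+ g ∧ m.cnt g < c}) atTop (𝓝 0) := by
  induction g with
  | nil =>
    intro _ _ c
    simpa only [List.suffix_nil] using hν.tendsto_root [] c
  | cons y g ih =>
    obtain ⟨a, o⟩ := y
    intro hg hN c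
    have hN' : g.length < N := by
      rw [List.length_cons] at hN
      omega
    refine tendsto_toOuterMeasure_zero_of_subset (hν.tendsto_root ((a, o) :: g) c)
      (hν.tendsto_failure ((P.obsProb_pos_iff _ _ _).1 hg.2)
        -- Fewer than `c` visits leave at most `c + 1` arrivals, so the failure is at least `2⁻¹ ^
        -- (c + 1)`.
        (isFailure_arrivals hγ0 hγ1 hK htie hN) (ih hg.1 hN') (ε := 2⁻¹ ^ (c + 1))
        (pow_ne_zero _ (by simp)) (ENNReal.pow_ne_top (by simp))) ?_
    rintro m ⟨hr, hmc⟩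
    rcases List.suffix_cons_iff.1 hr with hr | hr
    · exact Or.inl ⟨hr, hmc⟩
    · refine Or.inr ⟨hr, pow_le_pow_right_of_le_one' (by simp) ?_⟩
      unfold arrivals
      split_ifs <;> omega

theorem IsSearch.tendsto_leaf (hν : P.IsSearch γ τ K N tie ν) (hγ0 : 0 < γ) (hγ1 : γ < 1)
    (hK : 0 < K) (htie : ∀ F : Finset A, F.Nonempty → (tie F).support ⊆ (F : Set A))
    {c : Hist A Z} (hc : P.IsHistory c) (hN : c.length = N) (hres : P.residual γ τ c ≤ 0) :
    Tendsto (fun T => (ν T).toOuterMeasure {m | m.root <:+ c ∧ m.U c ≠ 0}) atTop (𝓝 0) := by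
  cases c with
  | nil =>
    obtain ⟨m, hm⟩ := (ν 0).support_nonempty
    obtain ⟨h1, h2, -⟩ := hν.valid 0 m hm
    have := h1.length
    rw [← hN, List.length_nil] at this
    omega
  | cons y g =>
    obtain ⟨a, o⟩ := y
    have hN' : g.length < N := by
      rw [← hN, List.length_cons]
      omega
    have hlim := hν.tendsto_failure ((P.obsProb_pos_iff _ _ _).1 hc.2) (isFailure_leaf hN hres)
      (hν.tendsto_cnt hγ0 hγ1 hK htie g hc.1 hN') one_ne_zero ENNReal.one_ne_top
    refine tendsto_of_tendsto_of_tendsto_of_le_of_le tendsto_const_nhds hlim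
      (fun _ => zero_le) fun T => PMF.toOuterMeasure_mono _ ?_
    rintro m ⟨⟨hr, hU⟩, hm⟩
    rcases List.suffix_cons_iff.1 hr with hr | hr
    · obtain ⟨h1, h2, -⟩ := hν.valid T m hm
      have := h1.length
      rw [hr, hN] at this
      omega
    · exact ⟨hr, by rw [if_neg hU]⟩

theorem IsSearch.tendsto_rootOptimal (hν : P.IsSearch γ τ K N tie ν) (hP : P.ObservableRewards)
    (hγ0 : 0 < γ) (hγ1 : γ < 1) (hK : 0 < K)
    (htie : ∀ F : Finset A, F.Nonempty → (tie F).support ⊆ (F : Set A)) :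
    Tendsto (fun T => (ν T).toOuterMeasure {m | P.RootOptimal γ N m}) atTop (𝓝 1) := by
  classical
  -- A union bound over the finitely many successful leaves controls the probability of a suboptimal
  -- root.
  have hfin : {c : Hist A Z | P.IsHistory c ∧ c.length = N ∧ P.residual γ τ c ≤ 0}.Finite :=
    (List.finite_length_eq (A × Z) N).subset fun c hc => hc.2.1
  have hsum : Tendsto (fun T => ∑ c ∈ hfin.toFinset,
      (ν T).toOuterMeasure {m | m.root <:+ c ∧ m.U c ≠ 0}) atTop (𝓝 0) := by
    refine (tendsto_finsetSum hfin.toFinset (a := fun _ => (0 : ℝ≥0∞)) fun c hc => ?_).trans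
      (by rw [Finset.sum_const_zero])
    obtain ⟨h1, h2, h3⟩ := hfin.mem_toFinset.1 hc
    exact hν.tendsto_leaf hγ0 hγ1 hK htie h1 h2 h3
  have hcompl : Tendsto (fun T => (ν T).toOuterMeasure {m | P.RootOptimal γ N m}ᶜ) atTop (𝓝 0) := by
    refine tendsto_of_tendsto_of_tendsto_of_le_of_le tendsto_const_nhds hsum
      (fun _ => zero_le) fun T => ?_
    refine le_trans (PMF.toOuterMeasure_mono (t := ⋃ c ∈ hfin.toFinset,
      {m : Memory A Z | m.root <:+ c ∧ m.U c ≠ 0}) _ ?_) (MeasureTheory.measure_biUnion_finset_le _ _)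
    rintro m ⟨hopt, hm⟩
    by_contra hnot
    refine hopt ((hν.valid T m hm).1.rootOptimal hP hγ0 fun c hr hc hN hres => ?_)
    by_contra hU
    exact hnot (Set.mem_biUnion (hfin.mem_toFinset.2 ⟨hc, hN, hres⟩) ⟨hr, hU⟩)
  have hsub : Tendsto (fun T => 1 - (ν T).toOuterMeasure {m | P.RootOptimal γ N m}ᶜ) atTop
      (𝓝 1) := by
    simpa using ENNReal.Tendsto.sub tendsto_const_nhds hcompl (Or.inl ENNReal.one_ne_top)
  exact tendsto_of_tendsto_of_tendsto_of_le_of_le hsub tendsto_const_nhds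
    (fun T => tsub_le_iff_right.2 ((ν T).one_le_toOuterMeasure_add_compl _))
    fun T => (ν T).toOuterMeasure_le_one _

end POMDP

/-! ### Search phases and whole executions -/

namespace POMDP

variable {S A Z : Type*} [Fintype S] [Fintype A] [Fintype Z] [Nonempty A]
variable {P : POMDP S A Z} {γ τ α K : ℝ} {N : ℕ} {m m' : Memory A Z} {tie : Finset A → PMF A}
  {select : Memory A Z → PMF (A × (Z → ℝ))}

theorem potential_ne_top {g : Hist A Z} {a : A} {o : Z} {Ψ : Memory A Z → ℝ≥0∞}
    (hΨ : P.IsFailure γ τ K N tie ((a, o) :: g) Ψ) (m : Memory A Z) :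
    P.potential g a o Ψ m ≠ ⊤ := by
  unfold potential
  split_ifs
  · exact ENNReal.mul_ne_top (ENNReal.pow_ne_top (ENNReal.inv_ne_top.2 (decay_ne_zero _ _)))
      (hΨ.ne_top m)
  · exact ENNReal.zero_ne_top

/-- The law of the memory after `T` calls of `Simulate`. -/
def searchLaw (P : POMDP S A Z) (γ K : ℝ) (tie : Finset A → PMF A) (m : Memory A Z) :
    ℕ → PMF (Memory A Z)
  | 0 => PMF.pure m
  | T + 1 => (P.searchLaw γ K tie m T).bind (P.simCall γ K tie)

theorem explore_map_headD (P : POMDP S A Z) (γ K : ℝ) (tie : Finset A → PMF A) (m : Memory A Z)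
    (T : ℕ) : (P.explore γ K tie T m).map (fun l => l.headD m) = P.searchLaw γ K tie m T := by
  induction T with
  | zero => simp [explore, searchLaw, PMF.pure_map]
  | succ T ih =>
    rw [explore, searchLaw, ← ih, PMF.map_bind, PMF.bind_map]
    congr 1
    funext l
    rw [PMF.map_comp]
    exact PMF.map_id _

theorem ne_nil_of_mem_support_explore {T : ℕ} {l : List (Memory A Z)}
    (hl : l ∈ (P.explore γ K tie T m).support) : l ≠ [] := by
  cases T with
  | zero =>
    rw [explore, PMF.mem_support_pure_iff] at hl
    simp [hl]
  | succ T =>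
    simp only [explore, PMF.mem_support_bind_iff, PMF.mem_support_map_iff] at hl
    obtain ⟨_, -, _, -, rfl⟩ := hl
    simp

/-- Optimality of the last memory suffices for optimality at some point of the search. -/
theorem searchLaw_le_explore (Q : Memory A Z → Prop) (T : ℕ) :
    (P.searchLaw γ K tie m T).toOuterMeasure {m' | Q m'} ≤
      (P.explore γ K tie T m).toOuterMeasure {l | ∃ m' ∈ l, Q m'} := by
  rw [← explore_map_headD, PMF.toOuterMeasure_map_apply]
  refine PMF.toOuterMeasure_mono _ ?_
  rintro l ⟨hl, hs⟩
  obtain ⟨x, l, rfl⟩ := List.exists_cons_of_ne_nil (ne_nil_of_mem_support_explore hs)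
  exact ⟨x, by simp, hl⟩

theorem searchLaw_support (hP : P.ObservableRewards) (hγ0 : 0 < γ) (hγ1 : γ < 1)
    (hK : 0 < K) (htie : ∀ F : Finset A, F.Nonempty → (tie F).support ⊆ (F : Set A))
    (hm : P.Valid γ τ K N m) (hn : 0 < m.n) (T : ℕ) :
    ∀ m' ∈ (P.searchLaw γ K tie m T).support,
      P.Valid γ τ K N m' ∧ m'.root = m.root ∧ m'.n = m.n ∧ T ≤ m'.cnt m.root := by
  induction T with
  | zero =>
    intro m' hm'
    rw [searchLaw, PMF.mem_support_pure_iff] at hm'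
    subst hm'
    exact ⟨hm, rfl, rfl, Nat.zero_le _⟩
  | succ T ih =>
    intro m' hm'
    rw [searchLaw, PMF.mem_support_bind_iff] at hm'
    obtain ⟨x, hx, hm'⟩ := hm'
    obtain ⟨h1, h2, h3, h4⟩ := ih x hx
    obtain ⟨h5, h6, h7, h8⟩ := simCall_support hP hγ0 hγ1 hK htie h1 (h3 ▸ hn) hm'
    rw [h2] at h8 h6
    exact ⟨h5, h6, h7.trans h3, by omega⟩

variable {g : Hist A Z} {a₀ : A} {o₀ : Z} {Ψ : Memory A Z → ℝ≥0∞}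

theorem expect_searchLaw_potential_le (hP : P.ObservableRewards) (hγ0 : 0 < γ) (hγ1 : γ < 1)
    (hK : 0 < K) (htie : ∀ F : Finset A, F.Nonempty → (tie F).support ⊆ (F : Set A))
    (hΨ : P.IsFailure γ τ K N tie ((a₀, o₀) :: g) Ψ) (hm : P.Valid γ τ K N m) (hn : 0 < m.n)
    (T : ℕ) :
    (P.searchLaw γ K tie m T).expect (P.potential g a₀ o₀ Ψ) ≤ P.potential g a₀ o₀ Ψ m := by
  induction T with
  | zero => rw [searchLaw, PMF.expect_pure]
  | succ T ih =>
    rw [searchLaw, PMF.expect_bind]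
    exact (PMF.expect_mono _ fun x hx => expect_simCall_potential_le hP hγ0 hγ1 hK htie hΨ
      (searchLaw_support hP hγ0 hγ1 hK htie hm hn T x hx).1).trans ih

theorem isSearch_searchLaw (hP : P.ObservableRewards) (hγ0 : 0 < γ) (hγ1 : γ < 1)
    (hK : 0 < K) (htie : ∀ F : Finset A, F.Nonempty → (tie F).support ⊆ (F : Set A))
    (hm : P.Valid γ τ K N m) (hn : 0 < m.n) :
    P.IsSearch γ τ K N tie (P.searchLaw γ K tie m) where
  valid T m' hm' := by
    obtain ⟨h1, h2, h3, h4⟩ := searchLaw_support hP hγ0 hγ1 hK htie hm hn T m' hm'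
    exact ⟨h1, h3 ▸ hn, h2.symm ▸ h4⟩
  bounded _ _ _ _ hΨ := ⟨_, potential_ne_top hΨ m, fun T =>
    expect_searchLaw_potential_le hP hγ0 hγ1 hK htie hΨ hm hn T⟩

theorem valid_initMemory (P : POMDP S A Z) (γ τ α K : ℝ) (N : ℕ) :
    P.Valid γ τ K N (initMemory N τ α) where
  counts :=
    { root_mem := rfl
      zero := fun _ _ _ => ⟨rfl, fun _ => rfl⟩
      sum := fun _ _ => by simp [initMemory]
      balance := fun _ _ _ _ => by
        norm_num [initMemory, visitBound]
      val := fun _ _ => by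
        simp only [initMemory, abs_zero]
        exact mul_nonneg (Nat.cast_nonneg _) P.rewardBound_nonneg }
  bounds :=
    { node := fun g _ _ => by
        have h : P.actionBound (fun _ => 1) g = fun _ => 1 := by
          funext a
          simp [actionBound]
        simp only [initMemory, nodeBound]
        rw [h, Finset.inf'_const]
      leaf := fun _ _ => Or.inl rfl }
  length := by simp [initMemory]
  isHistory := trivial
  thr := rfl

theorem Valid.afterPlay (hm : P.Valid γ τ K N m) (hn : 0 < m.n) {a : A} {o : Z}
    (ho : o ∈ (P.obsPMF m.root a).support) (d : Z → ℝ) :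
    P.Valid γ τ K N (afterPlay γ a d o (P.rew m.root a) m) where
  counts :=
    { root_mem := Set.mem_insert _ _
      zero := fun g hg hgs => hm.counts.zero g ((List.suffix_cons _ _).trans hg) fun h =>
        hgs (Set.mem_insert_of_mem _ ⟨h, hg⟩)
      sum := fun g hg => hm.counts.sum g ((List.suffix_cons _ _).trans hg)
      balance := fun g hg => hm.counts.balance g ((List.suffix_cons _ _).trans hg)
      val := hm.counts.val }
  bounds :=
    { node := fun g hg => hm.bounds.node g ((List.suffix_cons _ _).trans hg)
      leaf := hm.bounds.leaf }
  length := by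
    have := hm.length
    simp only [POMDP.afterPlay, List.length_cons]
    omega
  isHistory := isHistory_cons hm.isHistory ho
  thr := by
    simp only [POMDP.afterPlay, residual]
    rw [hm.thr]

/-- The invariants of the memory and the hidden state of an execution. -/
def StateValid (P : POMDP S A Z) (γ τ K : ℝ) (N : ℕ) (c : Memory A Z × S) : Prop :=
  P.Valid γ τ K N c.1 ∧ c.2 ∈ (P.belief c.1.root).support

theorem selectPlay_support (hP : P.ObservableRewards) {c c' : Memory A Z × S}
    (hc : P.StateValid γ τ K N c) (hn : 0 < c.1.n)
    (hc' : c' ∈ (P.selectPlay γ select c).support) :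
    P.StateValid γ τ K N c' ∧ c'.1.n = c.1.n - 1 := by
  simp only [selectPlay, PMF.mem_support_bind_iff, PMF.mem_support_map_iff] at hc'
  obtain ⟨⟨a, d⟩, -, s', hs', o, ho, rfl⟩ := hc'
  obtain ⟨h1, h2⟩ := mem_support_obsPMF_and_belief hc.2 hs' ho
  refine ⟨⟨?_, h2⟩, rfl⟩
  -- Since the hidden state lies in the support of the belief, the received reward is the one in the
  -- residual threshold.
  simp only [rew_eq hP hc.1.isHistory hc.2]
  exact hc.1.afterPlay hn h1 d

theorem expect_selectPlay_potential_le (hΨ : P.IsFailure γ τ K N tie ((a₀, o₀) :: g) Ψ)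
    (c : Memory A Z × S) :
    (P.selectPlay γ select c).expect (fun c' => P.potential g a₀ o₀ Ψ c'.1) ≤
      P.potential g a₀ o₀ Ψ c.1 := by
  simp only [selectPlay, PMF.expect_bind, PMF.expect_map]
  exact PMF.expect_le _ fun x _ => PMF.expect_le _ fun s' _ => PMF.expect_le _ fun o _ =>
    potential_afterPlay_le hΨ _ _ _ _ _

theorem Reachable.stateValid (hP : P.ObservableRewards) (hγ0 : 0 < γ) (hγ1 : γ < 1)
    (hK : 0 < K) (htie : ∀ F : Finset A, F.Nonempty → (tie F).support ⊆ (F : Set A))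
    {c : Memory A Z × S} (hc : P.Reachable γ K tie select N τ α c) :
    P.StateValid γ τ K N c := by
  induction hc with
  | start s hs => exact ⟨P.valid_initMemory γ τ α K N, hs⟩
  | sim m m' s _ hn hm ih =>
    obtain ⟨h1, h2, -⟩ := simCall_support hP hγ0 hγ1 hK htie ih.1 hn hm
    refine ⟨h1, ?_⟩
    simp only [h2]
    exact ih.2
  | play c c' _ hn hc ih => exact (selectPlay_support hP ih hn hc).1

theorem phaseStart_succ (P : POMDP S A Z) (γ K : ℝ) (tie : Finset A → PMF A)
    (select : Memory A Z → PMF (A × (Z → ℝ))) (N : ℕ) (τ α : ℝ) (T k : ℕ) :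
    P.phaseStart γ K tie select N τ α T (k + 1) =
      (P.phaseStart γ K tie select N τ α T k).bind fun c =>
        (P.searchLaw γ K tie c.1 T).bind fun m => P.selectPlay γ select (m, c.2) := by
  rw [phaseStart]
  congr 1
  funext c
  rw [← explore_map_headD, PMF.bind_map]
  rfl

theorem phaseStart_support (hP : P.ObservableRewards) (hγ0 : 0 < γ) (hγ1 : γ < 1)
    (hK : 0 < K) (htie : ∀ F : Finset A, F.Nonempty → (tie F).support ⊆ (F : Set A))
    (T k : ℕ) (hk : k < N) : ∀ c ∈ (P.phaseStart γ K tie select N τ α T k).support,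
      P.StateValid γ τ K N c ∧ c.1.n = N - k := by
  induction k with
  | zero =>
    intro c hc
    rw [phaseStart, PMF.mem_support_map_iff] at hc
    obtain ⟨s, hs, rfl⟩ := hc
    exact ⟨⟨P.valid_initMemory γ τ α K N, hs⟩, rfl⟩
  | succ k ih =>
    intro c hc
    simp only [phaseStart_succ, PMF.mem_support_bind_iff] at hc
    obtain ⟨c₀, hc₀, m, hm, hc⟩ := hc
    obtain ⟨h1, h2⟩ := ih (by omega) c₀ hc₀
    obtain ⟨h3, h4, h5, -⟩ := searchLaw_support hP hγ0 hγ1 hK htie h1.1 (by omega) T m hm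
    obtain ⟨h6, h7⟩ := selectPlay_support (c := (m, c₀.2)) hP ⟨h3, h4.symm ▸ h1.2⟩
      (show 0 < m.n by omega) hc
    exact ⟨h6, by rw [h7]; simp only; omega⟩

theorem expect_phaseStart_potential_le (hP : P.ObservableRewards) (hγ0 : 0 < γ) (hγ1 : γ < 1)
    (hK : 0 < K) (htie : ∀ F : Finset A, F.Nonempty → (tie F).support ⊆ (F : Set A))
    (hΨ : P.IsFailure γ τ K N tie ((a₀, o₀) :: g) Ψ) (T k : ℕ) (hk : k < N) :
    (P.phaseStart γ K tie select N τ α T k).expect (fun c => P.potential g a₀ o₀ Ψ c.1) ≤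
      P.potential g a₀ o₀ Ψ (initMemory N τ α) := by
  induction k with
  | zero =>
    rw [phaseStart, PMF.expect_map]
    exact PMF.expect_le _ fun _ _ => le_rfl
  | succ k ih =>
    rw [phaseStart_succ, PMF.expect_bind]
    refine (PMF.expect_mono _ fun c hc => ?_).trans (ih (by omega))
    obtain ⟨h1, h2⟩ := phaseStart_support hP hγ0 hγ1 hK htie T k (by omega) c hc
    rw [PMF.expect_bind]
    exact (PMF.expect_mono _ fun m _ => expect_selectPlay_potential_le hΨ (m, c.2)).trans
      (expect_searchLaw_potential_le hP hγ0 hγ1 hK htie hΨ h1.1 (by omega) T)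

/-- The bound is the potential of the initial memory, which does not involve the timeout `T` of the
earlier phases. -/
theorem isSearch_phase (hP : P.ObservableRewards) (hγ0 : 0 < γ) (hγ1 : γ < 1)
    (hK : 0 < K) (htie : ∀ F : Finset A, F.Nonempty → (tie F).support ⊆ (F : Set A))
    {k : ℕ} (hk : k < N) :
    P.IsSearch γ τ K N tie fun T => (P.phaseStart γ K tie select N τ α T k).bind
      fun c => P.searchLaw γ K tie c.1 T where
  valid T m hm := by
    rw [PMF.mem_support_bind_iff] at hm
    obtain ⟨c, hc, hm⟩ := hm
    obtain ⟨h1, h2⟩ := phaseStart_support hP hγ0 hγ1 hK htie T k hk c hc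
    obtain ⟨h3, h4, h5, h6⟩ := searchLaw_support hP hγ0 hγ1 hK htie h1.1 (by omega) T m hm
    exact ⟨h3, by omega, h4.symm ▸ h6⟩
  bounded g a o Ψ hΨ := by
    refine ⟨_, potential_ne_top hΨ (initMemory N τ α), fun T => ?_⟩
    rw [PMF.expect_bind]
    refine (PMF.expect_mono _ fun c hc => ?_).trans
      (expect_phaseStart_potential_le (select := select) hP hγ0 hγ1 hK htie hΨ T k hk)
    obtain ⟨h1, h2⟩ := phaseStart_support hP hγ0 hγ1 hK htie T k hk c hc
    exact expect_searchLaw_potential_le hP hγ0 hγ1 hK htie hΨ h1.1 (by omega) T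

end POMDP

end

/-! ### The lemma -/

theorem mainTheorem4 {S A Z : Type*} [Fintype S] [Fintype A] [Fintype Z] [Nonempty A]
    (P : POMDP S A Z) (hP : P.ObservableRewards)
    (γ : ℝ) (hγ0 : 0 < γ) (hγ1 : γ < 1) (N : ℕ) (τ α : ℝ)
    (K : ℝ) (hK : 0 < K)
    (tie : Finset A → PMF A)
    (htie : ∀ F : Finset A, F.Nonempty → (tie F).support ⊆ (F : Set A))
    (select : Memory A Z → PMF (A × (Z → ℝ))) :
    (∀ (m : Memory A Z) (s : S), P.Reachable γ K tie select N τ α (m, s) →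
      ∃ σ : Policy A Z,
        P.risk γ σ (P.belief m.root) (N - m.root.length) m.thr ≤ m.U m.root) ∧
    (∀ (m : Memory A Z) (s : S), P.Reachable γ K tie select N τ α (m, s) → 0 < m.n →
      Tendsto
        (fun T : ℕ => (P.explore γ K tie T m).toOuterMeasure
          {l | ∃ m' ∈ l, P.RootOptimal γ N m'})
        atTop (𝓝 1)) ∧
    (∀ k < N,
      Tendsto
        (fun T : ℕ => ((P.phaseStart γ K tie select N τ α T k).bind
          fun c => P.explore γ K tie T c.1).toOuterMeasure
            {l | ∃ m' ∈ l, P.RootOptimal γ N m'})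
        atTop (𝓝 1)) := by
  refine ⟨fun m s hm => (hm.stateValid hP hγ0 hγ1 hK htie).1.exists_risk_le hP hγ0,
    fun m s hm hn => ?_, fun k hk => ?_⟩
  · exact tendsto_of_tendsto_of_tendsto_of_le_of_le
      ((POMDP.isSearch_searchLaw hP hγ0 hγ1 hK htie (hm.stateValid hP hγ0 hγ1 hK htie).1
        hn).tendsto_rootOptimal hP hγ0 hγ1 hK htie) tendsto_const_nhds
      (POMDP.searchLaw_le_explore _) fun T => PMF.toOuterMeasure_le_one _ _
  · refine tendsto_of_tendsto_of_tendsto_of_le_of_le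
      ((POMDP.isSearch_phase (τ := τ) (α := α) (select := select) hP hγ0 hγ1 hK htie
        hk).tendsto_rootOptimal hP hγ0 hγ1 hK htie) tendsto_const_nhds
      (fun T => ?_) fun T => PMF.toOuterMeasure_le_one _ _
    simp only [PMF.toOuterMeasure_bind_apply]
    exact ENNReal.tsum_le_tsum fun c => mul_le_mul_right (POMDP.searchLaw_le_explore _ T) _
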